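/- **Proposition 4.9.** All vector spaces are over $\mathbb{C}$. A supermodule over a Lie superalgebra is a $\mathbb{Z}/2$-graded vector space, of arbitrary dimension, with a compatible action; homomorphisms and isomorphisms of supermodules are homogeneous of degree $0$; a supermodule is simple if it is nonzero and its only $\mathbb{Z}/2$-graded submodules are $0$ and itself. Let $\mathfrak{g}$ be $\mathfrak{gl}(m|n)$ with $m,n\ge 1$, or the periplectic Lie superalgebra $$\mathfrak{p}(n)=\left\{\begin{pmatrix} a & b\\ c & -a^{t}\end{pmatrix} : a,b,c\in\mathbb{C}^{n\times n},\ b=b^{t},\ c=-c^{t}\right\}\subseteq\mathfrak{gl}(n|n),\qquad n\ge 1.$$ Give $\mathfrak{g}$ the $\mathbb{Z}$-grading $\mathfrak{g}=\mathfrak{g}_{-1}\oplus\mathfrak{g}_0\oplus\mathfrak{g}_1$ in which $\mathfrak{g}_0$ consists of the block diagonal matrices in $\mathfrak{g}$, $\mathfrak{g}_1$ of those supported in the upper right block and $\mathfrak{g}_{-1}$ of those supported in the lower left block. Let $\mathfrak{g}'=[\mathfrak{g},\mathfrak{g}]$ be the span of all superbrackets of elements of $\mathfrak{g}$, let $\mathfrak{g}'_0=\mathfrak{g}'\cap\mathfrak{g}_0$,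 and for a $\mathfrak{g}$-supermodule $M$ let $M^{\mathfrak{g}_1}=\{v\in M : \mathfrak{g}_1 v=0\}$, which is a $\mathfrak{g}_0$-supermodule. Then: 1. If $M$ is a simple $\mathfrak{g}$-supermodule, then $\operatorname{Res}^{\mathfrak{g}}_{\mathfrak{g}'}(M)$ is a simple $\mathfrak{g}'$-supermodule. 2. If $M$ and $N$ are simple $\mathfrak{g}$-supermodules, then $\operatorname{Res}^{\mathfrak{g}}_{\mathfrak{g}'}(M)\cong\operatorname{Res}^{\mathfrak{g}}_{\mathfrak{g}'}(N)$ as $\mathfrak{g}'$-supermodules if and only if $M^{\mathfrak{g}_1}$ and $N^{\mathfrak{g}_1}$ are isomorphic as $\mathfrak{g}'_0$-supermodules. 3. Every simple $\mathfrak{g}'$-supermodule is of the form $\operatorname{Res}^{\mathfrak{g}}_{\mathfrak{g}'}(M)$ for some simple $\mathfrak{g}$-supermodule $M$. -/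

import Mathlib

universe u v

namespace SuperLie

/-- The sign `(-1)^{ij}` of the super sign rule. -/
noncomputable def sgn (i j : ZMod 2) : ℂ := (-1) ^ (i.val * j.val)

/-- A subspace `W` of a `ℤ/2`-graded space is graded if it is spanned by its homogeneous
elements. -/
def IsGradedSubspace {V : Type*} [AddCommGroup V] [Module ℂ V]
    (part : ZMod 2 → Submodule ℂ V) (W : Submodule ℂ V) : Prop :=
  W ≤ (W ⊓ part 0) ⊔ (W ⊓ part 1)

/-- A complex Lie superalgebra structure on `L = L₀ ⊕ L₁`. -/
structure LieSuperalgebra (L : Type*) [AddCommGroup L] [Module ℂ L] where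
  part : ZMod 2 → Submodule ℂ L
  isCompl : IsCompl (part 0) (part 1)
  bracket : L →ₗ[ℂ] L →ₗ[ℂ] L
  bracket_mem : ∀ i j x y, x ∈ part i → y ∈ part j → bracket x y ∈ part (i + j)
  skew : ∀ i j x y, x ∈ part i → y ∈ part j →
    bracket x y = -(sgn i j • bracket y x)
  jacobi : ∀ i j k x y z, x ∈ part i → y ∈ part j → z ∈ part k →
    bracket x (bracket y z) = bracket (bracket x y) z + sgn i j • bracket y (bracket x z)

section General

variable {L : Type*} [AddCommGroup L] [Module ℂ L]

/-- A Lie sub-superalgebra: a graded subspace closed under the bracket. -/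
structure Subsuperalgebra (A : LieSuperalgebra L) where
  carrier : Submodule ℂ L
  graded : IsGradedSubspace A.part carrier
  bracket_mem : ∀ x ∈ carrier, ∀ y ∈ carrier, A.bracket x y ∈ carrier

variable {A : LieSuperalgebra L}

/-- The whole Lie superalgebra, as a sub-superalgebra of itself. -/
def Subsuperalgebra.whole (A : LieSuperalgebra L) : Subsuperalgebra A where
  carrier := ⊤
  graded := by
    unfold IsGradedSubspace
    rw [top_inf_eq, top_inf_eq, A.isCompl.sup_eq_top]
  bracket_mem := fun _ _ _ _ => Submodule.mem_top

/-- The derived superalgebra `[g, g]`: the span of all brackets of elements of `g`. -/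
def Subsuperalgebra.derived (g : Subsuperalgebra A) : Subsuperalgebra A where
  carrier := Submodule.span ℂ {z | ∃ x ∈ g.carrier, ∃ y ∈ g.carrier, A.bracket x y = z}
  graded := by
    have key : ∀ i j x y, x ∈ g.carrier → y ∈ g.carrier → x ∈ A.part i → y ∈ A.part j →
        A.bracket x y ∈
          (Submodule.span ℂ {z | ∃ x ∈ g.carrier, ∃ y ∈ g.carrier, A.bracket x y = z} ⊓ A.part 0)
          ⊔ (Submodule.span ℂ {z | ∃ x ∈ g.carrier, ∃ y ∈ g.carrier, A.bracket x y = z}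
            ⊓ A.part 1) := by
      intro i j x y hx hy hxi hyj
      have h1 := A.bracket_mem i j x y hxi hyj
      have h2 : A.bracket x y ∈
          Submodule.span ℂ {z | ∃ x ∈ g.carrier, ∃ y ∈ g.carrier, A.bracket x y = z} :=
        Submodule.subset_span ⟨x, hx, y, hy, rfl⟩
      have h3 : i + j = 0 ∨ i + j = 1 := by
        generalize i + j = k
        revert k
        decide
      rcases h3 with h3 | h3
      · rw [h3] at h1
        exact Submodule.mem_sup_left ⟨h2, h1⟩
      · rw [h3] at h1
        exact Submodule.mem_sup_right ⟨h2, h1⟩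
    unfold IsGradedSubspace
    refine Submodule.span_le.mpr ?_
    rintro z ⟨x, hx, y, hy, rfl⟩
    obtain ⟨x0, ⟨hx0, hx0'⟩, x1, ⟨hx1, hx1'⟩, rfl⟩ := Submodule.mem_sup.mp (g.graded hx)
    obtain ⟨y0, ⟨hy0, hy0'⟩, y1, ⟨hy1, hy1'⟩, rfl⟩ := Submodule.mem_sup.mp (g.graded hy)
    rw [map_add A.bracket, LinearMap.add_apply, map_add, map_add]
    exact add_mem
      (add_mem (key 0 0 x0 y0 hx0 hy0 hx0' hy0') (key 0 1 x0 y1 hx0 hy1 hx0' hy1'))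
      (add_mem (key 1 0 x1 y0 hx1 hy0 hx1' hy0') (key 1 1 x1 y1 hx1 hy1 hx1' hy1'))
  bracket_mem := by
    have hle : Submodule.span ℂ {z | ∃ x ∈ g.carrier, ∃ y ∈ g.carrier, A.bracket x y = z}
        ≤ g.carrier := by
      refine Submodule.span_le.mpr ?_
      rintro z ⟨x, hx, y, hy, rfl⟩
      exact g.bracket_mem x hx y hy
    exact fun x hx y hy => Submodule.subset_span ⟨x, hle hx, y, hle hy, rfl⟩

theorem Subsuperalgebra.derived_le (g : Subsuperalgebra A) :
    g.derived.carrier ≤ g.carrier := by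
  refine Submodule.span_le.mpr ?_
  rintro z ⟨x, hx, y, hy, rfl⟩
  exact g.bracket_mem x hx y hy

/-- A `g`-supermodule structure on the vector space `V`: a `ℤ/2`-grading of `V` and an
action of `g`, compatible with the gradings and the bracket. -/
structure Supermodule (g : Subsuperalgebra A) (V : Type*) [AddCommGroup V] [Module ℂ V] where
  part : ZMod 2 → Submodule ℂ V
  isCompl : IsCompl (part 0) (part 1)
  act : g.carrier →ₗ[ℂ] Module.End ℂ V
  act_mem : ∀ i j (x : g.carrier) (v : V), (x : L) ∈ A.part i → v ∈ part j →
    act x v ∈ part (i + j)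
  act_bracket : ∀ i j (x y : g.carrier), (x : L) ∈ A.part i → (y : L) ∈ A.part j →
    act ⟨A.bracket x y, g.bracket_mem x x.2 y y.2⟩ = act x * act y - sgn i j • (act y * act x)

namespace Supermodule

variable {g h : Subsuperalgebra A}
variable {V : Type*} [AddCommGroup V] [Module ℂ V] {W : Type*} [AddCommGroup W] [Module ℂ W]

/-- Sub-supermodules: graded subspaces stable under the action. -/
def IsSub (M : Supermodule g V) (U : Submodule ℂ V) : Prop :=
  IsGradedSubspace M.part U ∧ ∀ (x : g.carrier), ∀ u ∈ U, M.act x u ∈ U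

/-- A supermodule is simple if it is nonzero and has no proper nonzero sub-supermodule. -/
def IsSimple (M : Supermodule g V) : Prop :=
  Nontrivial V ∧ ∀ U : Submodule ℂ V, M.IsSub U → U = ⊥ ∨ U = ⊤

/-- Isomorphism of supermodules, by a map that is homogeneous of degree zero. -/
def IsIso (M : Supermodule g V) (N : Supermodule g W) : Prop :=
  ∃ e : V ≃ₗ[ℂ] W, (∀ i, ∀ v ∈ M.part i, e v ∈ N.part i) ∧
    ∀ (x : g.carrier) (v : V), e (M.act x v) = N.act x (e v)

/-- Restriction of a `g`-supermodule to a sub-superalgebra `h ⊆ g`. -/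
def res (M : Supermodule g V) (hle : h.carrier ≤ g.carrier) : Supermodule h V where
  part := M.part
  isCompl := M.isCompl
  act := M.act ∘ₗ Submodule.inclusion hle
  act_mem := fun i j x v hx hv => M.act_mem i j (Submodule.inclusion hle x) v hx hv
  act_bracket := fun i j x y hx hy =>
    M.act_bracket i j (Submodule.inclusion hle x) (Submodule.inclusion hle y) hx hy

/-- A sub-supermodule, as a supermodule. -/
def sub (M : Supermodule g V) (U : Submodule ℂ V) (hU : M.IsSub U) : Supermodule g U where
  part := fun i => (M.part i).comap U.subtype
  isCompl := by
    constructor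
    · rw [Submodule.disjoint_def]
      intro x h0 h1
      exact Subtype.ext (Submodule.disjoint_def.mp M.isCompl.disjoint x.1 h0 h1)
    · rw [codisjoint_iff, eq_top_iff]
      rintro ⟨x, hx⟩ -
      obtain ⟨a, ⟨ha, ha'⟩, b, ⟨hb, hb'⟩, hab⟩ := Submodule.mem_sup.mp (hU.1 hx)
      exact Submodule.mem_sup.mpr ⟨⟨a, ha⟩, ha', ⟨b, hb⟩, hb', Subtype.ext hab⟩
  act :=
    { toFun := fun x => (M.act x).restrict (hU.2 x)
      map_add' := fun x y => by
        ext u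
        simp
      map_smul' := fun c x => by
        ext u
        simp }
  act_mem := fun i j x v hx hv => M.act_mem i j x v.1 hx hv
  act_bracket := fun i j x y hx hy => by
    ext u
    have h1 := LinearMap.congr_fun (M.act_bracket i j x y hx hy) u.1
    simpa using h1

end Supermodule

end General

section Matrices

variable {m n : ℕ}

/-- Position of a basis vector of `ℂ^{m|n}`: `0` for the even ones, `1` for the odd ones. -/
def pos : Fin m ⊕ Fin n → ℤ
  | Sum.inl _ => 0
  | Sum.inr _ => 1

/-- Square matrices of size `m + n`, in block form. -/
abbrev Mat (m n : ℕ) : Type := Matrix (Fin m ⊕ Fin n) (Fin m ⊕ Fin n) ℂ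

/-- The piece of degree `k` of the `ℤ`-grading of `gl(m|n)`: block diagonal matrices for
`k = 0`, matrices supported in the upper right block for `k = 1`, matrices supported in
the lower left block for `k = -1`, and zero otherwise. -/
def glDegree (m n : ℕ) (k : ℤ) : Submodule ℂ (Mat m n) where
  carrier := {X | ∀ i j, pos j - pos i ≠ k → X i j = 0}
  zero_mem' := fun _ _ _ => rfl
  add_mem' := fun {X Y} hX hY i j h => by
    rw [Matrix.add_apply, hX i j h, hY i j h, add_zero]
  smul_mem' := fun c X hX i j h => by
    rw [Matrix.smul_apply, hX i j h, smul_zero]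

/-- The `ℤ/2`-grading of `gl(m|n)`: even matrices are block diagonal, odd matrices are
block off-diagonal. -/
def glPart (m n : ℕ) (k : ZMod 2) : Submodule ℂ (Mat m n) where
  carrier := {X | ∀ i j, ((pos j - pos i : ℤ) : ZMod 2) ≠ k → X i j = 0}
  zero_mem' := fun _ _ _ => rfl
  add_mem' := fun {X Y} hX hY i j h => by
    rw [Matrix.add_apply, hX i j h, hY i j h, add_zero]
  smul_mem' := fun c X hX i j h => by
    rw [Matrix.smul_apply, hX i j h, smul_zero]

/-- The odd component of a matrix. -/
def oddPart : Mat m n →ₗ[ℂ] Mat m n where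
  toFun X := Matrix.fromBlocks 0 X.toBlocks₁₂ X.toBlocks₂₁ 0
  map_add' X Y := by
    ext (i | i) (j | j) <;> simp [Matrix.toBlocks₁₂, Matrix.toBlocks₂₁]
  map_smul' c X := by
    ext (i | i) (j | j) <;> simp [Matrix.toBlocks₁₂, Matrix.toBlocks₂₁]

/-- The supercommutator, written bilinearly; for homogeneous matrices it is
`X Y - (-1)^{|X||Y|} Y X`. -/
def superComm : Mat m n →ₗ[ℂ] Mat m n →ₗ[ℂ] Mat m n :=
  LinearMap.mk₂ ℂ (fun X Y => X * Y - Y * X + (2 : ℂ) • (oddPart Y * oddPart X))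
    (fun X X' Y => by
      simp only [map_add, add_mul, mul_add, smul_add]
      abel)
    (fun c X Y => by
      simp only [map_smul, Matrix.smul_mul, Matrix.mul_smul, smul_add, smul_sub]
      rw [smul_comm])
    (fun X Y Y' => by
      simp only [map_add, add_mul, mul_add, smul_add]
      abel)
    (fun c X Y => by
      simp only [map_smul, Matrix.smul_mul, Matrix.mul_smul, smul_add, smul_sub]
      rw [smul_comm])

theorem oddPart_of_even {X : Mat m n} (hX : X ∈ glPart m n 0) : oddPart X = 0 := by
  ext (i | i) (j | j)
  · rfl
  · exact hX (Sum.inl i) (Sum.inr j) (by simp [pos])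
  · exact hX (Sum.inr i) (Sum.inl j) (by simp [pos])
  · rfl

theorem oddPart_of_odd {X : Mat m n} (hX : X ∈ glPart m n 1) : oddPart X = X := by
  ext (i | i) (j | j)
  · exact (hX (Sum.inl i) (Sum.inl j) (by simp [pos])).symm
  · rfl
  · rfl
  · exact (hX (Sum.inr i) (Sum.inr j) (by simp [pos])).symm

theorem zmod2_cases (i : ZMod 2) : i = 0 ∨ i = 1 := by
  revert i
  decide

theorem sgn_one_one : sgn 1 1 = -1 := by simp [sgn, ZMod.val_one]

theorem sgn_zero_left (i : ZMod 2) : sgn 0 i = 1 := by simp [sgn]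

theorem sgn_zero_right (i : ZMod 2) : sgn i 0 = 1 := by simp [sgn]

theorem superComm_homogeneous (i j : ZMod 2) (X Y : Mat m n) (hX : X ∈ glPart m n i)
    (hY : Y ∈ glPart m n j) : superComm X Y = X * Y - sgn i j • (Y * X) := by
  have h : superComm X Y = X * Y - Y * X + (2 : ℂ) • (oddPart Y * oddPart X) := rfl
  rw [h]
  rcases zmod2_cases i with rfl | rfl
  · rw [oddPart_of_even hX, sgn_zero_left]
    simp
  rcases zmod2_cases j with rfl | rfl
  · rw [oddPart_of_even hY, sgn_zero_right]
    simp
  · rw [oddPart_of_odd hX, oddPart_of_odd hY, sgn_one_one, two_smul, neg_smul, one_smul]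
    abel

theorem mul_mem_glPart (i j : ZMod 2) (X Y : Mat m n) (hX : X ∈ glPart m n i)
    (hY : Y ∈ glPart m n j) : X * Y ∈ glPart m n (i + j) := by
  intro a b hab
  rw [Matrix.mul_apply]
  refine Finset.sum_eq_zero fun c _ => ?_
  by_cases h1 : ((pos c - pos a : ℤ) : ZMod 2) = i
  · by_cases h2 : ((pos b - pos c : ℤ) : ZMod 2) = j
    · exfalso
      apply hab
      rw [← h1, ← h2]
      push_cast
      ring
    · rw [hY c b h2, mul_zero]
  · rw [hX a c h1, zero_mul]

theorem superComm_mem (i j : ZMod 2) (X Y : Mat m n) (hX : X ∈ glPart m n i)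
    (hY : Y ∈ glPart m n j) : superComm X Y ∈ glPart m n (i + j) := by
  rw [superComm_homogeneous i j X Y hX hY]
  refine sub_mem (mul_mem_glPart i j X Y hX hY) (Submodule.smul_mem _ _ ?_)
  rw [add_comm]
  exact mul_mem_glPart j i Y X hY hX

/-- The general linear Lie superalgebra `gl(m|n)`. -/
def gl (m n : ℕ) : LieSuperalgebra (Mat m n) where
  part := glPart m n
  isCompl := by
    constructor
    · rw [Submodule.disjoint_def]
      intro X h0 h1
      rw [← oddPart_of_odd h1, oddPart_of_even h0]
    · rw [codisjoint_iff, eq_top_iff]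
      intro X _
      refine Submodule.mem_sup.mpr ⟨X - oddPart X, ?_, oddPart X, ?_, sub_add_cancel _ _⟩
      · rintro (i | i) (j | j) h
        · simp [pos] at h
        · exact sub_self _
        · exact sub_self _
        · simp [pos] at h
      · rintro (i | i) (j | j) h
        · rfl
        · simp [pos] at h
        · simp [pos] at h
        · rfl
  bracket := superComm
  bracket_mem := superComm_mem
  skew := by
    intro i j X Y hX hY
    rw [superComm_homogeneous i j X Y hX hY, superComm_homogeneous j i Y X hY hX]
    rcases zmod2_cases i with rfl | rfl <;> rcases zmod2_cases j with rfl | rfl <;>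
      simp [sgn_one_one, sgn_zero_left, sgn_zero_right, add_comm]
  jacobi := by
    intro i j k X Y Z hX hY hZ
    rw [superComm_homogeneous i (j + k) X _ hX (superComm_mem j k Y Z hY hZ),
      superComm_homogeneous (i + j) k _ Z (superComm_mem i j X Y hX hY) hZ,
      superComm_homogeneous j (i + k) Y _ hY (superComm_mem i k X Z hX hZ),
      superComm_homogeneous i j X Y hX hY, superComm_homogeneous j k Y Z hY hZ,
      superComm_homogeneous i k X Z hX hZ]
    have h2 : (1 : ZMod 2) + 1 = 0 := by decide
    rcases zmod2_cases i with rfl | rfl <;> rcases zmod2_cases j with rfl | rfl <;>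
      rcases zmod2_cases k with rfl | rfl <;>
      simp only [h2, zero_add, add_zero, sgn_one_one, sgn_zero_left, sgn_zero_right,
        one_smul, neg_smul] <;>
      noncomm_ring

/-- The periplectic Lie superalgebra `p(n) ⊆ gl(n|n)`: block matrices `(a, b; c, -aᵗ)` with
`b` symmetric and `c` skew-symmetric. -/
def periplectic (n : ℕ) : Subsuperalgebra (gl n n) where
  carrier :=
    { carrier := {X | X.toBlocks₂₂ = -X.toBlocks₁₁.transpose ∧
        X.toBlocks₁₂.transpose = X.toBlocks₁₂ ∧ X.toBlocks₂₁.transpose = -X.toBlocks₂₁}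
      zero_mem' := by
        refine ⟨?_, ?_, ?_⟩ <;> ext i j <;>
          simp [Matrix.toBlocks₁₁, Matrix.toBlocks₂₂, Matrix.toBlocks₁₂, Matrix.toBlocks₂₁]
      add_mem' := by
        rintro X Y ⟨h1, h2, h3⟩ ⟨k1, k2, k3⟩
        refine ⟨?_, ?_, ?_⟩
        · change X.toBlocks₂₂ + Y.toBlocks₂₂ = -(X.toBlocks₁₁ + Y.toBlocks₁₁).transpose
          rw [h1, k1, Matrix.transpose_add, neg_add]
        · change (X.toBlocks₁₂ + Y.toBlocks₁₂).transpose = X.toBlocks₁₂ + Y.toBlocks₁₂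
          rw [Matrix.transpose_add, h2, k2]
        · change (X.toBlocks₂₁ + Y.toBlocks₂₁).transpose = -(X.toBlocks₂₁ + Y.toBlocks₂₁)
          rw [Matrix.transpose_add, h3, k3, neg_add]
      smul_mem' := by
        rintro c X ⟨h1, h2, h3⟩
        refine ⟨?_, ?_, ?_⟩
        · change c • X.toBlocks₂₂ = -(c • X.toBlocks₁₁).transpose
          rw [h1, Matrix.transpose_smul, smul_neg]
        · change (c • X.toBlocks₁₂).transpose = c • X.toBlocks₁₂
          rw [Matrix.transpose_smul, h2]
        · change (c • X.toBlocks₂₁).transpose = -(c • X.toBlocks₂₁)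
          rw [Matrix.transpose_smul, h3, smul_neg] }
  graded := by
    rintro X ⟨h1, h2, h3⟩
    refine Submodule.mem_sup.mpr ⟨X - oddPart X, ⟨⟨?_, ?_, ?_⟩, ?_⟩, oddPart X,
      ⟨⟨?_, ?_, ?_⟩, ?_⟩, sub_add_cancel _ _⟩
    · change X.toBlocks₂₂ - 0 = -(X.toBlocks₁₁ - 0).transpose
      rw [sub_zero, sub_zero, h1]
    · change (X.toBlocks₁₂ - X.toBlocks₁₂).transpose = X.toBlocks₁₂ - X.toBlocks₁₂
      rw [sub_self, Matrix.transpose_zero]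
    · change (X.toBlocks₂₁ - X.toBlocks₂₁).transpose = -(X.toBlocks₂₁ - X.toBlocks₂₁)
      rw [sub_self, Matrix.transpose_zero, neg_zero]
    · rintro (i | i) (j | j) h
      · simp [pos] at h
      · exact sub_self _
      · exact sub_self _
      · simp [pos] at h
    · change (0 : Matrix (Fin n) (Fin n) ℂ) = -(0 : Matrix (Fin n) (Fin n) ℂ).transpose
      rw [Matrix.transpose_zero, neg_zero]
    · exact h2
    · exact h3
    · rintro (i | i) (j | j) h
      · rfl
      · simp [pos] at h
      · simp [pos] at h
      · rfl
  bracket_mem := by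
    rintro X ⟨h1, h2, h3⟩ Y ⟨k1, k2, k3⟩
    change superComm X Y ∈ _
    have h : superComm X Y = X * Y - Y * X + (2 : ℂ) • (oddPart Y * oddPart X) := rfl
    have hX := (Matrix.fromBlocks_toBlocks X).symm
    have hY := (Matrix.fromBlocks_toBlocks Y).symm
    have hX' : oddPart X = Matrix.fromBlocks 0 X.toBlocks₁₂ X.toBlocks₂₁ 0 := rfl
    have hY' : oddPart Y = Matrix.fromBlocks 0 Y.toBlocks₁₂ Y.toBlocks₂₁ 0 := rfl
    rw [hX', hY'] at h
    generalize X.toBlocks₁₁ = a at *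
    generalize X.toBlocks₁₂ = b at *
    generalize X.toBlocks₂₁ = c at *
    generalize X.toBlocks₂₂ = d at *
    generalize Y.toBlocks₁₁ = a' at *
    generalize Y.toBlocks₁₂ = b' at *
    generalize Y.toBlocks₂₁ = c' at *
    generalize Y.toBlocks₂₂ = d' at *
    subst h1 k1 hX hY
    rw [h]
    simp only [Matrix.fromBlocks_multiply, sub_eq_add_neg, Matrix.fromBlocks_neg, Matrix.fromBlocks_smul,
      Matrix.fromBlocks_add]
    refine ⟨?_, ?_, ?_⟩ <;>
      simp only [Matrix.toBlocks_fromBlocks₁₁, Matrix.toBlocks_fromBlocks₁₂,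
        Matrix.toBlocks_fromBlocks₂₁, Matrix.toBlocks_fromBlocks₂₂, Matrix.transpose_add,
        Matrix.transpose_mul, Matrix.transpose_neg,
        Matrix.transpose_transpose, Matrix.transpose_zero, h2, h3, k2, k3,
        two_smul] <;>
      noncomm_ring

/-- `g` is `gl(m|n)`, or `m = n` and `g` is `p(n)`. -/
inductive IsGlOrP : {m n : ℕ} → Subsuperalgebra (gl m n) → Prop
  | gl (m n : ℕ) : IsGlOrP (Subsuperalgebra.whole (gl m n))
  | p (n : ℕ) : IsGlOrP (periplectic n)

theorem glDegree_zero_le : glDegree m n 0 ≤ glPart m n 0 := by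
  intro X hX i j h
  refine hX i j fun h0 => h ?_
  rw [h0, Int.cast_zero]

theorem glDegree_one_le : glDegree m n 1 ≤ glPart m n 1 := by
  intro X hX i j h
  refine hX i j fun h0 => h ?_
  rw [h0, Int.cast_one]

theorem mul_mem_glDegree (k l : ℤ) (X Y : Mat m n) (hX : X ∈ glDegree m n k)
    (hY : Y ∈ glDegree m n l) : X * Y ∈ glDegree m n (k + l) := by
  intro a b hab
  rw [Matrix.mul_apply]
  refine Finset.sum_eq_zero fun c _ => ?_
  by_cases h1 : pos c - pos a = k
  · by_cases h2 : pos b - pos c = l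
    · exact absurd (by rw [← h1, ← h2]; ring) hab
    · rw [hY c b h2, mul_zero]
  · rw [hX a c h1, zero_mul]

/-- The degree zero part `g_0 = g ∩ gl(m|n)_0` of `g ⊆ gl(m|n)`. -/
def Subsuperalgebra.degZero (g : Subsuperalgebra (gl m n)) : Subsuperalgebra (gl m n) where
  carrier := g.carrier ⊓ glDegree m n 0
  graded := fun _ hX => Submodule.mem_sup_left ⟨hX, glDegree_zero_le hX.2⟩
  bracket_mem := fun X hX Y hY => by
    refine ⟨g.bracket_mem X hX.1 Y hY.1, ?_⟩
    change superComm X Y ∈ _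
    rw [superComm_homogeneous 0 0 X Y (glDegree_zero_le hX.2) (glDegree_zero_le hY.2)]
    exact sub_mem (mul_mem_glDegree 0 0 X Y hX.2 hY.2)
      (Submodule.smul_mem _ _ (mul_mem_glDegree 0 0 Y X hY.2 hX.2))

theorem Subsuperalgebra.degZero_le (g : Subsuperalgebra (gl m n)) :
    g.degZero.carrier ≤ g.carrier := inf_le_left

theorem Subsuperalgebra.derived_degZero_le (g : Subsuperalgebra (gl m n)) :
    g.derived.degZero.carrier ≤ g.degZero.carrier :=
  inf_le_inf_right _ g.derived_le

variable {g : Subsuperalgebra (gl m n)} {V : Type*} [AddCommGroup V] [Module ℂ V]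

/-- The subspace `M^{g_1}` of vectors killed by `g_1 = g ∩ gl(m|n)_1`. -/
def Supermodule.invariants (M : Supermodule g V) : Submodule ℂ V where
  carrier := {v | ∀ x : g.carrier, (x : Mat m n) ∈ glDegree m n 1 → M.act x v = 0}
  zero_mem' := fun x _ => map_zero _
  add_mem' := fun {v w} hv hw x hx => by rw [map_add, hv x hx, hw x hx, add_zero]
  smul_mem' := fun c v hv x hx => by rw [map_smul, hv x hx, smul_zero]

theorem Supermodule.invariants_isSub (M : Supermodule g V) :
    (M.res g.degZero_le).IsSub M.invariants := by
  constructor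
  · intro v hv
    have hv' : v ∈ M.part 0 ⊔ M.part 1 := by
      rw [M.isCompl.sup_eq_top]
      exact Submodule.mem_top
    obtain ⟨a, ha, b, hb, rfl⟩ := Submodule.mem_sup.mp hv'
    have key : ∀ x : g.carrier, (x : Mat m n) ∈ glDegree m n 1 →
        M.act x a = 0 ∧ M.act x b = 0 := by
      intro x hx
      have h1 : M.act x a ∈ M.part 1 := M.act_mem 1 0 x a (glDegree_one_le hx) ha
      have h2 : M.act x b ∈ M.part 0 := M.act_mem 1 1 x b (glDegree_one_le hx) hb
      have h3 : M.act x a + M.act x b = 0 := by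
        rw [← map_add]
        exact hv x hx
      have h4 : M.act x a = 0 := by
        refine Submodule.disjoint_def.mp M.isCompl.disjoint _ ?_ h1
        rw [eq_neg_of_add_eq_zero_left h3]
        exact neg_mem h2
      refine ⟨h4, ?_⟩
      rwa [h4, zero_add] at h3
    exact Submodule.mem_sup.mpr
      ⟨a, ⟨fun x hx => (key x hx).1, ha⟩, b, ⟨fun x hx => (key x hx).2, hb⟩, rfl⟩
  · intro x v hv y hy
    have hx0 : (x : Mat m n) ∈ glDegree m n 0 := x.2.2
    have hbr := M.act_bracket 0 1 ⟨x.1, x.2.1⟩ y (glDegree_zero_le hx0) (glDegree_one_le hy)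
    have hdeg : (gl m n).bracket x.1 y.1 ∈ glDegree m n 1 := by
      change superComm x.1 y.1 ∈ _
      rw [superComm_homogeneous 0 1 _ _ (glDegree_zero_le hx0) (glDegree_one_le hy)]
      have h1 := mul_mem_glDegree 0 1 _ _ hx0 hy
      have h2 := mul_mem_glDegree 1 0 _ _ hy hx0
      rw [zero_add] at h1
      rw [add_zero] at h2
      exact sub_mem h1 (Submodule.smul_mem _ _ h2)
    have h3 := LinearMap.congr_fun hbr v
    rw [hv _ hdeg, sgn_zero_left, one_smul, LinearMap.sub_apply, Module.End.mul_apply,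
      Module.End.mul_apply, hv y hy, map_zero, zero_sub] at h3
    exact neg_eq_zero.mp h3.symm

/-- `M^{g_1}` as a `g_0`-supermodule. -/
def Supermodule.invariantsModule (M : Supermodule g V) :
    Supermodule g.degZero M.invariants :=
  (M.res g.degZero_le).sub M.invariants M.invariants_isSub

end Matrices

end SuperLie

/-! Two facts about `g` drive everything. The element z = diag(1/2, -1/2) lies in `g`, and ad z is
multiplication by k on degree k; its supertrace (m + n)/2 is nonzero, while g' is the
supertrace-zero part of `g` (`mem_derived_iff`). Hence g = g' ⊕ ℂz, and g' contains g_1 and g_{-1}.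

Let `M` be simple over an algebra with pieces in degrees -1, 0, 1 only; both `g` and g' qualify
(`IsTriangular`). Products of sufficiently many elements of g_1, or of g_{-1}, act by zero, so
M^{g_1} is nonzero. A nonzero graded g_0-stable subspace W of M^{g_1} generates the sum of its
layers g_{-1}^i W, which must be M. From this, M^{g_1} meets the positive layers trivially
(`IsSimple.invariants_inf_tail`), M^{g_1} is simple over g_0 (`IsSimple.eq_invariants`), and M is
the direct sum of the layers of M^{g_1} (`IsSimple.iSupIndep_layer`).

Restriction (`IsSimple.res_derived`): z commutes with g_0, so it acts on M^{g_1} by a scalar. As M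
may be infinite-dimensional, Schur's lemma is obtained by Dixmier's argument: M^{g_1} has countable
dimension and ℂ is uncountable. A nonzero g'-submodule X then meets M^{g_1} in a nonzero g_0-stable
subspace, so X contains M^{g_1} and all its layers.

Isomorphisms (`isIso_of_highest_graph`): the graph of an isomorphism M^{g_1} ≅ N^{g_1} over g'_0
generates a g'-submodule of M × N, which by simplicity is the graph of an isomorphism M ≅ N.

Extension (`IsSimple.exists_res_eq`): on a simple g'-module the operator D equal to -i on the i-th
layer satisfies [D, x] = kx for x of degree k, exactly the relations of z, so z can be made to act
by D. -/

namespace SuperLie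

/-! ### Spectral values in countable dimension; nilpotency of anticommuting operators. -/

section LinearAlgebra

variable {V : Type*} [AddCommGroup V] [Module ℂ V]

-- Over ℂ a nonzero polynomial is a nonzero constant times linear factors, each of which is
-- injective at `z`.
open Polynomial in
theorem aeval_injective_of_sub_injective (z : Module.End ℂ V)
    (hz : ∀ a : ℂ, Function.Injective (z - algebraMap ℂ (Module.End ℂ V) a))
    (p : ℂ[X]) (hp : p ≠ 0) : Function.Injective (aeval z p) := by
  have hprod : ∀ s : Multiset ℂ,
      Function.Injective (aeval z (Multiset.map (fun a => X - C a) s).prod) := by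
    intro s
    induction s using Multiset.induction_on with
    | empty => exact fun x y h => by simpa using h
    | cons a s ih =>
      rw [Multiset.map_cons, Multiset.prod_cons, map_mul, map_sub, aeval_X, aeval_C]
      exact (hz a).comp ih
  rw [(IsAlgClosed.splits p).eq_prod_roots, map_mul, aeval_C]
  have hc : p.leadingCoeff ≠ 0 := leadingCoeff_ne_zero.mpr hp
  have : Function.Injective (algebraMap ℂ (Module.End ℂ V) p.leadingCoeff) := by
    intro x y hxy
    simpa [Module.algebraMap_end_apply, hc] using hxy
  exact this.comp (hprod _)

open Polynomial in
/-- An endomorphism of a nonzero complex vector space of countable dimension has a spectral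
value. -/
theorem exists_not_bijective_sub_algebraMap [Nontrivial V]
    (hV : Module.rank ℂ V ≤ Cardinal.aleph0) (z : Module.End ℂ V) :
    ∃ a : ℂ, ¬ Function.Bijective (z - algebraMap ℂ (Module.End ℂ V) a) := by
  by_contra! hz
  obtain ⟨v, hv⟩ := exists_ne (0 : V)
  choose w hw using fun a => (hz a).2 v
  -- Here `w a` is (z - a)⁻¹v. Clearing denominators in a relation ∑ c_b w_b = 0 gives Q(z)v = 0,
  -- and Q(a) = c_a ∏ (a - d) ≠ 0, against injectivity of Q(z). So there are continuum many
  -- independent vectors, too many for countable dimension.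
  have hlin : LinearIndependent ℂ w := by
    rw [linearIndependent_iff']
    intro s c hs a ha
    by_contra hca
    let Q : ℂ[X] := ∑ b ∈ s, C (c b) * ∏ d ∈ s.erase b, (X - C d)
    have hQ : Q ≠ 0 := by
      intro hQ
      have h1 : Q.eval a = 0 := by rw [hQ, eval_zero]
      rw [eval_finsetSum, Finset.sum_eq_single a] at h1
      · rw [eval_mul, eval_C, eval_prod] at h1
        rcases mul_eq_zero.mp h1 with h1 | h1
        · exact hca h1
        · obtain ⟨d, hd, h2⟩ := Finset.prod_eq_zero_iff.mp h1
          rw [eval_sub, eval_X, eval_C, sub_eq_zero] at h2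
          exact (Finset.mem_erase.mp hd).1 h2.symm
      · intro b hb hba
        rw [eval_mul, eval_prod, Finset.prod_eq_zero (Finset.mem_erase.mpr ⟨hba.symm, ha⟩), mul_zero]
        simp
      · exact fun h => absurd ha h
    have h1 : aeval z Q v = 0 := by
      have h2 : aeval z (∏ d ∈ s, (X - C d)) (∑ b ∈ s, c b • w b) = aeval z Q v := by
        rw [map_sum, map_sum, LinearMap.sum_apply]
        refine Finset.sum_congr rfl fun b hb => ?_
        rw [← Finset.prod_erase_mul s _ hb, map_mul, map_mul, Module.End.mul_apply, map_smul]
        have h3 : aeval z (X - C b) (w b) = v := by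
          rw [map_sub, aeval_X, aeval_C]
          exact hw b
        rw [h3, aeval_C, map_smul, Module.End.mul_apply, Module.algebraMap_end_apply]
      rw [← h2, hs, map_zero]
    exact hv (aeval_injective_of_sub_injective z (fun a => (hz a).1) Q hQ (h1.trans (map_zero _).symm))
  have h1 := hlin.cardinal_lift_le_rank
  have h2 : Cardinal.lift.{_, 0} (Cardinal.mk ℂ) ≤ Cardinal.aleph0 :=
    h1.trans (by simpa using hV)
  rw [Cardinal.mk_complex, Cardinal.lift_continuum] at h2
  exact absurd h2 (not_le.mpr Cardinal.aleph0_lt_continuum)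

/-- A cyclic module over a finitely generated algebra of operators has countable dimension. -/
theorem rank_le_aleph0_of_adjoin {S : Set (Module.End ℂ V)} (hS : S.Countable) (v : V)
    (U : Submodule ℂ V) (hU : ∀ u ∈ U, ∃ a ∈ Algebra.adjoin ℂ S, a v = u) :
    Module.rank ℂ U ≤ Cardinal.aleph0 := by
  have hcl : (Submonoid.closure S : Set (Module.End ℂ V)).Countable := by
    rw [Submonoid.closure_eq_mrange, MonoidHom.coe_mrange]
    have := hS.to_subtype
    have : Countable (FreeMonoid S) := inferInstanceAs (Countable (List S))
    exact Set.countable_range _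
  let T : Set V := (fun a : Module.End ℂ V => a v) '' Submonoid.closure S
  have hT : T.Countable := hcl.image _
  have hle : U ≤ Submodule.span ℂ T := by
    intro u hu
    obtain ⟨a, ha, rfl⟩ := hU u hu
    have ha' : a ∈ Submodule.span ℂ (Submonoid.closure S : Set (Module.End ℂ V)) := by
      rw [← Algebra.adjoin_eq_span]
      exact ha
    have h1 := Submodule.mem_map_of_mem (f := LinearMap.applyₗ (R := ℂ) (M₂ := V) v) ha'
    rw [Submodule.map_span] at h1
    exact h1
  exact (Submodule.rank_mono hle).trans ((rank_span_le T).trans hT.le_aleph0)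

/-- A finite-dimensional space of anticommuting operators is nilpotent. -/
theorem exists_pow_eq_bot_of_anticommute (S : Submodule ℂ (Module.End ℂ V))
    [FiniteDimensional ℂ S] (hS : ∀ x ∈ S, ∀ y ∈ S, x * y + y * x = 0) : ∃ d : ℕ, S ^ d = ⊥ := by
  -- Operators of square zero extend to the exterior algebra of `S`, where any dim S + 1 vectors
  -- have zero product.
  have hsq : ∀ x : S, S.subtype x * S.subtype x = 0 := by
    intro x
    have h := hS x x.2 x x.2
    rw [← two_smul ℂ] at h
    exact (smul_eq_zero.mp h).resolve_left two_ne_zero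
  refine ⟨Module.finrank ℂ S + 1, ?_⟩
  rw [Submodule.pow_eq_span_pow_set, Submodule.span_eq_bot]
  intro x hx
  obtain ⟨f, rfl⟩ := Set.mem_pow.mp hx
  let f' : Fin (Module.finrank ℂ S + 1) → S := f
  have h1 : ExteriorAlgebra.ιMulti ℂ _ f' = 0 := by
    refine AlternatingMap.map_linearDependent _ _ fun hlin => ?_
    have := hlin.fintype_card_le_finrank
    simp at this
  have h2 := congrArg (ExteriorAlgebra.lift ℂ ⟨S.subtype, hsq⟩) h1
  rw [ExteriorAlgebra.ιMulti_apply, map_list_prod, map_zero, List.map_ofFn] at h2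
  rw [← h2]
  congr 2
  funext i
  simp [f']

theorem pow_succ_smul (S : Submodule ℂ (Module.End ℂ V)) (i : ℕ) (W : Submodule ℂ V) :
    S ^ (i + 1) • W = S • S ^ i • W := by
  induction i generalizing W with
  | zero => rw [Submodule.pow_succ, Submodule.pow_zero, Submodule.one_mul, Submodule.one_smul]
  | succ i ih =>
    rw [Submodule.pow_succ, ← smul_eq_mul, Submodule.smul_assoc, ih, ← Submodule.smul_assoc (S ^ i),
      smul_eq_mul, ← Submodule.pow_succ]

end LinearAlgebra

/-! ### Trace-zero matrices and commutators. -/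

section Commutators

variable {ι : Type*} [Fintype ι] [DecidableEq ι]

/-- A matrix of trace zero is a sum of commutators. -/
theorem mem_span_commutators_of_trace_eq_zero (a : Matrix ι ι ℂ) (ha : a.trace = 0) :
    a ∈ Submodule.span ℂ {z : Matrix ι ι ℂ | ∃ x y, x * y - y * x = z} := by
  rcases isEmpty_or_nonempty ι with h | ⟨⟨o⟩⟩
  · rw [Subsingleton.elim a 0]
    exact zero_mem _
  -- The corrections at the fixed index `o` add up to tr(a) E_oo = 0 when `a` is expanded in matrix
  -- units.
  have key : ∀ i j, Matrix.single i j (1 : ℂ) - (if i = j then Matrix.single o o (1 : ℂ) else 0) ∈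
      Submodule.span ℂ {z : Matrix ι ι ℂ | ∃ x y, x * y - y * x = z} := by
    intro i j
    by_cases hij : i = j
    · subst hij
      refine Submodule.subset_span ⟨Matrix.single i o 1, Matrix.single o i 1, ?_⟩
      simp
    · refine Submodule.subset_span ⟨Matrix.single i i 1, Matrix.single i j 1, ?_⟩
      rw [if_neg hij, Matrix.single_mul_single_same, Matrix.single_mul_single_of_ne _ _ _ _ (Ne.symm hij)]
      simp
  have h1 : a = ∑ i, ∑ j, a i j • (Matrix.single i j (1 : ℂ) -
      (if i = j then Matrix.single o o (1 : ℂ) else 0)) := by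
    simp only [smul_sub, Finset.sum_sub_distrib, smul_ite, smul_zero, Finset.sum_ite_eq,
      Finset.mem_univ, if_true]
    rw [← Finset.sum_smul]
    have : ∑ i, a i i = 0 := ha
    rw [this, zero_smul, sub_zero]
    conv_lhs => rw [Matrix.matrix_eq_sum_single a]
    simp
  rw [h1]
  exact Submodule.sum_mem _ fun i _ => Submodule.sum_mem _ fun j _ => Submodule.smul_mem _ _ (key i j)

end Commutators

/-! ### The ℤ-grading. -/

section Degrees

variable {m n : ℕ}

theorem glDegree_le_glPart (k : ℤ) : glDegree m n k ≤ glPart m n (k : ZMod 2) := by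
  intro X hX i j h
  refine hX i j fun h0 => h ?_
  rw [h0]

theorem superComm_mem_glDegree {k l : ℤ} {X Y : Mat m n} (hX : X ∈ glDegree m n k)
    (hY : Y ∈ glDegree m n l) : superComm X Y ∈ glDegree m n (k + l) := by
  rw [superComm_homogeneous k l X Y (glDegree_le_glPart k hX) (glDegree_le_glPart l hY)]
  refine sub_mem (mul_mem_glDegree k l X Y hX hY) (Submodule.smul_mem _ _ ?_)
  rw [add_comm]
  exact mul_mem_glDegree l k Y X hY hX

theorem glDegree_eq_bot {k : ℤ} (hk : k < -1 ∨ 1 < k) : glDegree m n k = ⊥ := by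
  rw [eq_bot_iff]
  intro X hX
  rw [Submodule.mem_bot]
  ext (i | i) (j | j) <;> refine hX _ _ ?_ <;> simp only [pos] <;> omega

/-- A sub-superalgebra of `gl(m|n)` that is the sum of its pieces of degrees `-1`, `0`, `1`. -/
def IsTriangular (g : Subsuperalgebra (gl m n)) : Prop :=
  ∀ x ∈ g.carrier, ∃ a ∈ g.carrier ⊓ glDegree m n (-1), ∃ b ∈ g.carrier ⊓ glDegree m n 0,
    ∃ c ∈ g.carrier ⊓ glDegree m n 1, a + b + c = x

end Degrees

namespace Supermodule

/-! ### The parity operator. -/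

section Parity

variable {L : Type*} [AddCommGroup L] [Module ℂ L] {A : LieSuperalgebra L}
  {g : Subsuperalgebra A} {V : Type*} [AddCommGroup V] [Module ℂ V] (M : Supermodule g V)

/-- The parity operator: `1` on the even part and `-1` on the odd part. -/
noncomputable def parity : Module.End ℂ V :=
  (M.part 0).projection (M.part 1) M.isCompl - (M.part 1).projection (M.part 0) M.isCompl.symm

theorem parity_of_even {v : V} (hv : v ∈ M.part 0) : M.parity v = v := by
  rw [parity, LinearMap.sub_apply, Submodule.projection_apply_of_mem_left _ hv,
    Submodule.projection_apply_of_mem_right _ hv, sub_zero]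

theorem parity_of_odd {v : V} (hv : v ∈ M.part 1) : M.parity v = -v := by
  rw [parity, LinearMap.sub_apply, Submodule.projection_apply_of_mem_left _ hv,
    Submodule.projection_apply_of_mem_right _ hv, zero_sub]

theorem exists_even_add_odd (v : V) : ∃ a ∈ M.part 0, ∃ b ∈ M.part 1, a + b = v :=
  Submodule.mem_sup.mp (M.isCompl.sup_eq_top ▸ Submodule.mem_top)

theorem parity_eq_self_iff {v : V} : M.parity v = v ↔ v ∈ M.part 0 := by
  refine ⟨fun h => ?_, M.parity_of_even⟩
  obtain ⟨a, ha, b, hb, rfl⟩ := M.exists_even_add_odd v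
  rw [map_add, M.parity_of_even ha, M.parity_of_odd hb] at h
  have hb0 : b = 0 := by
    have h1 := add_left_cancel h
    rwa [neg_eq_iff_add_eq_zero, ← two_smul ℂ, smul_eq_zero_iff_right two_ne_zero] at h1
  rwa [hb0, add_zero]

theorem parity_eq_neg_iff {v : V} : M.parity v = -v ↔ v ∈ M.part 1 := by
  refine ⟨fun h => ?_, M.parity_of_odd⟩
  obtain ⟨a, ha, b, hb, rfl⟩ := M.exists_even_add_odd v
  rw [map_add, M.parity_of_even ha, M.parity_of_odd hb, neg_add] at h
  have ha0 : a = 0 := by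
    have h1 := add_right_cancel h
    rwa [eq_neg_iff_add_eq_zero, ← two_smul ℂ, smul_eq_zero_iff_right two_ne_zero] at h1
  rwa [ha0, zero_add]

/-- Gradedness becomes stability under one more operator, since the components of u are (u ± parity
u)/2. -/
theorem isGradedSubspace_iff {U : Submodule ℂ V} :
    IsGradedSubspace M.part U ↔ ∀ u ∈ U, M.parity u ∈ U := by
  constructor
  · intro h u hu
    obtain ⟨a, ha, b, hb, rfl⟩ := Submodule.mem_sup.mp (h hu)
    rw [map_add, M.parity_of_even ha.2, M.parity_of_odd hb.2]
    exact add_mem ha.1 (neg_mem hb.1)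
  · intro h u hu
    obtain ⟨a, ha, b, hb, rfl⟩ := M.exists_even_add_odd u
    have h1 := h _ hu
    rw [map_add, M.parity_of_even ha, M.parity_of_odd hb] at h1
    have ha' : a ∈ U := by
      have h2 : (2 : ℂ) • a ∈ U := by
        have : (2 : ℂ) • a = (a + b) + (a + -b) := by rw [two_smul]; abel
        rw [this]
        exact add_mem hu h1
      exact (U.smul_mem_iff two_ne_zero).mp h2
    exact Submodule.mem_sup.mpr ⟨a, ⟨ha', ha⟩, b, ⟨(U.add_mem_iff_right ha').mp hu, hb⟩, rfl⟩

theorem parity_act_even {x : g.carrier} (hx : (x : L) ∈ A.part 0) (v : V) :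
    M.parity (M.act x v) = M.act x (M.parity v) := by
  obtain ⟨a, ha, b, hb, rfl⟩ := M.exists_even_add_odd v
  have h0 : M.act x a ∈ M.part 0 := M.act_mem 0 0 x a hx ha
  have h1 : M.act x b ∈ M.part 1 := M.act_mem 0 1 x b hx hb
  simp only [map_add, M.parity_of_even ha, M.parity_of_odd hb, M.parity_of_even h0,
    M.parity_of_odd h1, map_neg]

theorem parity_act_odd {x : g.carrier} (hx : (x : L) ∈ A.part 1) (v : V) :
    M.parity (M.act x v) = -M.act x (M.parity v) := by
  obtain ⟨a, ha, b, hb, rfl⟩ := M.exists_even_add_odd v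
  have h0 : M.act x a ∈ M.part 1 := M.act_mem 1 0 x a hx ha
  have h1 : M.act x b ∈ M.part 0 := M.act_mem 1 1 x b hx hb
  simp only [map_add, M.parity_of_even ha, M.parity_of_odd hb, M.parity_of_even h1,
    M.parity_of_odd h0, map_neg, neg_add, neg_neg]

end Parity

/-! ### Operators of each degree, and existence of invariants. -/

variable {m n : ℕ} {g : Subsuperalgebra (gl m n)} {V : Type*} [AddCommGroup V] [Module ℂ V]
  (M : Supermodule g V)

/-- The operators by which the elements of degree `k` act. -/
noncomputable def ops (k : ℤ) : Submodule ℂ (Module.End ℂ V) :=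
  ((glDegree m n k).comap g.carrier.subtype).map M.act

theorem act_mem_ops {k : ℤ} {x : g.carrier} (hx : (x : Mat m n) ∈ glDegree m n k) :
    M.act x ∈ M.ops k := Submodule.mem_map_of_mem hx

instance (k : ℤ) : FiniteDimensional ℂ (M.ops k) := by
  unfold ops
  infer_instance

theorem ops_eq_bot {k : ℤ} (hk : k < -1 ∨ 1 < k) : M.ops k = ⊥ := by
  rw [eq_bot_iff]
  rintro _ ⟨x, hx, rfl⟩
  rw [glDegree_eq_bot hk] at hx
  have : x = 0 := Subtype.ext ((Submodule.mem_bot ℂ).mp hx)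
  rw [this, map_zero]
  exact zero_mem _

theorem ops_superComm {k l : ℤ} {S T : Module.End ℂ V} (hS : S ∈ M.ops k) (hT : T ∈ M.ops l) :
    S * T - sgn k l • (T * S) ∈ M.ops (k + l) := by
  obtain ⟨x, hx, rfl⟩ := hS
  obtain ⟨y, hy, rfl⟩ := hT
  rw [← M.act_bracket k l x y (glDegree_le_glPart k hx) (glDegree_le_glPart l hy)]
  exact M.act_mem_ops (superComm_mem_glDegree hx hy)

theorem ops_zero_comm {k : ℤ} {S T : Module.End ℂ V} (hS : S ∈ M.ops 0) (hT : T ∈ M.ops k) :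
    S * T - T * S ∈ M.ops k := by
  have h := M.ops_superComm hS hT
  rwa [Int.cast_zero, sgn_zero_left, one_smul, zero_add] at h

theorem ops_one_anticomm {S T : Module.End ℂ V} (hS : S ∈ M.ops 1) (hT : T ∈ M.ops (-1)) :
    S * T + T * S ∈ M.ops 0 := by
  have h := M.ops_superComm hS hT
  rwa [Int.cast_neg, Int.cast_one, ZMod.neg_eq_self_mod_two, sgn_one_one, neg_one_smul,
    sub_neg_eq_add, add_neg_cancel] at h

/-- Degrees ±2 are zero, so the odd operators of degree `k` anticommute. -/
theorem exists_ops_pow_eq_bot {k : ℤ} (hk : k = 1 ∨ k = -1) : ∃ d : ℕ, M.ops k ^ d = ⊥ := by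
  refine exists_pow_eq_bot_of_anticommute _ fun S hS T hT => ?_
  have h := M.ops_superComm hS hT
  have h2 : M.ops (k + k) = ⊥ := M.ops_eq_bot (by omega)
  have h3 : (k : ZMod 2) = 1 := by rcases hk with rfl | rfl <;> decide
  rwa [h2, h3, sgn_one_one, neg_one_smul, sub_neg_eq_add, Submodule.mem_bot] at h

theorem parity_ops_zero {S : Module.End ℂ V} (hS : S ∈ M.ops 0) (v : V) :
    M.parity (S v) = S (M.parity v) := by
  obtain ⟨x, hx, rfl⟩ := hS
  exact M.parity_act_even (glDegree_le_glPart 0 hx) v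

theorem parity_ops_neg_one {S : Module.End ℂ V} (hS : S ∈ M.ops (-1)) (v : V) :
    M.parity (S v) = -S (M.parity v) := by
  obtain ⟨x, hx, rfl⟩ := hS
  exact M.parity_act_odd (glDegree_le_glPart (-1) hx) v

theorem mem_invariants_iff {v : V} : v ∈ M.invariants ↔ ∀ S ∈ M.ops 1, S v = 0 := by
  constructor
  · rintro h _ ⟨x, hx, rfl⟩
    exact h x hx
  · exact fun h x hx => h _ (M.act_mem_ops hx)

theorem isSub_of_ops_le (hg : IsTriangular g) {U : Submodule ℂ V} (hp : ∀ u ∈ U, M.parity u ∈ U)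
    (hl : M.ops (-1) • U ≤ U) (h0 : M.ops 0 • U ≤ U) (h1 : M.ops 1 • U ≤ U) : M.IsSub U := by
  refine ⟨M.isGradedSubspace_iff.mpr hp, fun x u hu => ?_⟩
  obtain ⟨a, ha, b, hb, c, hc, habc⟩ := hg x x.2
  have hx : x = ⟨a, ha.1⟩ + ⟨b, hb.1⟩ + ⟨c, hc.1⟩ := Subtype.ext habc.symm
  rw [hx, map_add, map_add]
  refine add_mem (add_mem ?_ ?_) ?_
  · exact hl (Submodule.smul_mem_smul (M.act_mem_ops (x := ⟨a, ha.1⟩) ha.2) hu)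
  · exact h0 (Submodule.smul_mem_smul (M.act_mem_ops (x := ⟨b, hb.1⟩) hb.2) hu)
  · exact h1 (Submodule.smul_mem_smul (M.act_mem_ops (x := ⟨c, hc.1⟩) hc.2) hu)

variable {M}

theorem IsSub.ops_smul_le {U : Submodule ℂ V} (hU : M.IsSub U) (k : ℤ) : M.ops k • U ≤ U := by
  rw [Submodule.smul_le]
  rintro _ ⟨x, -, rfl⟩ u hu
  exact hU.2 x u hu

theorem IsSub.parity_mem {U : Submodule ℂ V} (hU : M.IsSub U) {u : V} (hu : u ∈ U) :
    M.parity u ∈ U := M.isGradedSubspace_iff.mp hU.1 u hu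

theorem parity_mem_invariants {v : V} (hv : v ∈ M.invariants) : M.parity v ∈ M.invariants :=
  (M.res g.degZero_le).isGradedSubspace_iff.mp M.invariants_isSub.1 v hv

theorem ops_zero_smul_invariants : M.ops 0 • M.invariants ≤ M.invariants := by
  rw [Submodule.smul_le]
  rintro _ ⟨x, hx, rfl⟩ v hv
  exact M.invariants_isSub.2 ⟨x.1, x.2, hx⟩ v hv

theorem ops_one_smul_eq_bot_iff {U : Submodule ℂ V} : M.ops 1 • U = ⊥ ↔ U ≤ M.invariants := by
  rw [eq_bot_iff, Submodule.smul_le]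
  exact ⟨fun h v hv => M.mem_invariants_iff.mpr fun S hS => h S hS v hv,
    fun h S hS v hv => M.mem_invariants_iff.mp (h hv) S hS⟩

/-- A nonzero subspace stable under `g_1` contains nonzero `g_1`-invariants. -/
theorem inf_invariants_ne_bot {U : Submodule ℂ V} (hU : M.ops 1 • U ≤ U) (h0 : U ≠ ⊥) :
    U ⊓ M.invariants ≠ ⊥ := by
  classical
  have hex : ∃ d : ℕ, M.ops 1 ^ d • U = ⊥ := by
    obtain ⟨d, hd⟩ := M.exists_ops_pow_eq_bot (Or.inl rfl)
    exact ⟨d, by rw [hd, Submodule.bot_smul]⟩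
  have hle : ∀ i : ℕ, M.ops 1 ^ i • U ≤ U := by
    intro i
    induction i with
    | zero => rw [Submodule.pow_zero, Submodule.one_smul]
    | succ i ih =>
      rw [pow_succ_smul]
      exact (Submodule.smul_mono le_rfl ih).trans hU
  -- The last nonzero g_1^d U is killed by g_1.
  obtain ⟨d, hd, hmin⟩ : ∃ d : ℕ, M.ops 1 ^ (d + 1) • U = ⊥ ∧ M.ops 1 ^ d • U ≠ ⊥ := by
    have hpos : Nat.find hex ≠ 0 := by
      intro h
      have := Nat.find_spec hex
      rw [h, Submodule.pow_zero, Submodule.one_smul] at this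
      exact h0 this
    refine ⟨Nat.find hex - 1, ?_, Nat.find_min hex (by omega)⟩
    rw [Nat.sub_add_cancel (Nat.one_le_iff_ne_zero.mpr hpos)]
    exact Nat.find_spec hex
  rw [pow_succ_smul, ops_one_smul_eq_bot_iff] at hd
  exact ne_bot_of_le_ne_bot hmin (le_inf (hle d) hd)

/-! ### Layers generated from highest-weight subspaces. -/

variable (M)

/-- The image of `W` under products of `i` elements of `g_{-1}`. -/
noncomputable def layer (W : Submodule ℂ V) (i : ℕ) : Submodule ℂ V := M.ops (-1) ^ i • W

theorem layer_zero (W : Submodule ℂ V) : M.layer W 0 = W := by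
  rw [layer, Submodule.pow_zero, Submodule.one_smul]

theorem layer_succ (W : Submodule ℂ V) (i : ℕ) :
    M.layer W (i + 1) = M.ops (-1) • M.layer W i := by
  rw [layer, pow_succ_smul, layer]

/-- The sum of all layers but the first. -/
noncomputable def tail (W : Submodule ℂ V) : Submodule ℂ V := ⨆ i, M.layer W (i + 1)

theorem sup_tail (W : Submodule ℂ V) : W ⊔ M.tail W = ⨆ i, M.layer W i := by
  rw [tail, ← sup_iSup_nat_succ (M.layer W), layer_zero]

theorem layer_mono {W W' : Submodule ℂ V} (h : W ≤ W') (i : ℕ) : M.layer W i ≤ M.layer W' i :=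
  Submodule.smul_mono le_rfl h

theorem tail_mono {W W' : Submodule ℂ V} (h : W ≤ W') : M.tail W ≤ M.tail W' :=
  iSup_mono fun i => M.layer_mono h (i + 1)

theorem layer_le_of_le {W U : Submodule ℂ V} (hU : M.ops (-1) • U ≤ U) (h : W ≤ U) (i : ℕ) :
    M.layer W i ≤ U := by
  induction i with
  | zero => rwa [layer_zero]
  | succ i ih =>
    rw [layer_succ]
    exact (Submodule.smul_mono le_rfl ih).trans hU

theorem tail_eq_smul (W : Submodule ℂ V) : M.tail W = M.ops (-1) • ⨆ i, M.layer W i := by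
  simp only [tail, layer_succ, Submodule.smul_iSup]

/-- A graded subspace of the `g_1`-invariants that is stable under `g_0`. -/
structure IsHighest (W : Submodule ℂ V) : Prop where
  parity_mem : ∀ w ∈ W, M.parity w ∈ W
  ops_zero_smul_le : M.ops 0 • W ≤ W
  le_invariants : W ≤ M.invariants

theorem isHighest_invariants : M.IsHighest M.invariants :=
  ⟨fun _ => parity_mem_invariants, ops_zero_smul_invariants, le_rfl⟩

variable {M}

end Supermodule

/-! ### Layer decomposition of a simple supermodule. -/

namespace Supermodule

variable {m n : ℕ} {g : Subsuperalgebra (gl m n)} {V : Type*} [AddCommGroup V] [Module ℂ V]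
  {M : Supermodule g V}

namespace IsHighest

variable {W : Submodule ℂ V}

theorem parity_mem_layer (hW : M.IsHighest W) (i : ℕ) {v : V} (hv : v ∈ M.layer W i) :
    M.parity v ∈ M.layer W i := by
  induction i generalizing v with
  | zero =>
    rw [layer_zero] at hv ⊢
    exact hW.parity_mem v hv
  | succ i ih =>
    rw [layer_succ] at hv ⊢
    refine Submodule.smul_induction_on hv (fun S hS w hw => ?_) fun x y hx hy => ?_
    · rw [Module.End.smul_def, M.parity_ops_neg_one hS]
      exact neg_mem (Submodule.smul_mem_smul hS (ih hw))
    · rw [map_add]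
      exact add_mem hx hy

theorem ops_zero_smul_layer_le (hW : M.IsHighest W) (i : ℕ) :
    M.ops 0 • M.layer W i ≤ M.layer W i := by
  induction i with
  | zero =>
    rw [layer_zero]
    exact hW.ops_zero_smul_le
  | succ i ih =>
    rw [layer_succ, Submodule.smul_le]
    intro S hS v hv
    refine Submodule.smul_induction_on hv (fun T hT w hw => ?_) fun x y hx hy => ?_
    · have h : S • T • w = T • S • w + (S * T - T * S) • w := by
        simp only [Module.End.smul_def, LinearMap.sub_apply, Module.End.mul_apply]
        abel
      rw [h]
      exact add_mem (Submodule.smul_mem_smul hT (ih (Submodule.smul_mem_smul hS hw)))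
        (Submodule.smul_mem_smul (M.ops_zero_comm hS hT) hw)
    · rw [smul_add]
      exact add_mem hx hy

theorem ops_one_smul_layer_zero (hW : M.IsHighest W) : M.ops 1 • M.layer W 0 = ⊥ := by
  rw [layer_zero, ops_one_smul_eq_bot_iff]
  exact hW.le_invariants

/-- For S in g_1 and T in g_{-1}, ST = (ST + TS) - TS, where ST + TS comes from g_0 and preserves
layers. In the second term S first lowers the layer by induction, or kills it at the bottom, and T
raises it again. -/
theorem ops_one_smul_layer_succ_le (hW : M.IsHighest W) (i : ℕ) :
    M.ops 1 • M.layer W (i + 1) ≤ M.layer W i := by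
  have key : ∀ i, (∀ S ∈ M.ops 1, ∀ T ∈ M.ops (-1), ∀ w ∈ M.layer W i, T • S • w ∈ M.layer W i) →
      M.ops 1 • M.layer W (i + 1) ≤ M.layer W i := by
    intro i hi
    rw [layer_succ, Submodule.smul_le]
    intro S hS v hv
    refine Submodule.smul_induction_on hv (fun T hT w hw => ?_) fun x y hx hy => ?_
    · have h : S • T • w = (S * T + T * S) • w - T • S • w := by
        simp only [Module.End.smul_def, LinearMap.add_apply, Module.End.mul_apply]
        abel
      rw [h]
      exact sub_mem (hW.ops_zero_smul_layer_le i
        (Submodule.smul_mem_smul (M.ops_one_anticomm hS hT) hw)) (hi S hS T hT w hw)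
    · rw [smul_add]
      exact add_mem hx hy
  induction i with
  | zero =>
    refine key 0 fun S hS T hT w hw => ?_
    have h0 : S • w = 0 := by
      have := Submodule.smul_mem_smul hS hw
      rwa [hW.ops_one_smul_layer_zero, Submodule.mem_bot] at this
    rw [h0, smul_zero]
    exact zero_mem _
  | succ i ih =>
    refine key (i + 1) fun S hS T hT w hw => ?_
    rw [layer_succ]
    exact Submodule.smul_mem_smul hT (ih (Submodule.smul_mem_smul hS hw))

theorem isSub_iSup_layer (hg : IsTriangular g) (hW : M.IsHighest W) :
    M.IsSub (⨆ i, M.layer W i) := by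
  refine M.isSub_of_ops_le hg (fun u hu => ?_) ?_ ?_ ?_
  · refine Submodule.iSup_induction _ (motive := fun u => M.parity u ∈ ⨆ i, M.layer W i) hu
      (fun i v hv => Submodule.mem_iSup_of_mem i (hW.parity_mem_layer i hv)) ?_ fun x y hx hy => ?_
    · rw [map_zero]
      exact zero_mem _
    · rw [map_add]
      exact add_mem hx hy
  · rw [← tail_eq_smul, ← sup_tail]
    exact le_sup_right
  · rw [Submodule.smul_iSup]
    exact iSup_mono hW.ops_zero_smul_layer_le
  · rw [Submodule.smul_iSup, iSup_le_iff]
    intro i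
    cases i with
    | zero =>
      rw [hW.ops_one_smul_layer_zero]
      exact bot_le
    | succ i => exact (hW.ops_one_smul_layer_succ_le i).trans (le_iSup _ i)

/-- The sum of the layers is a sub-supermodule containing `W`. -/
theorem sup_tail_eq_top (hg : IsTriangular g) (hM : M.IsSimple) (hW : M.IsHighest W)
    (h0 : W ≠ ⊥) : W ⊔ M.tail W = ⊤ := by
  rw [sup_tail]
  refine (hM.2 _ (hW.isSub_iSup_layer hg)).resolve_left fun h => h0 ?_
  rw [eq_bot_iff, ← h, ← sup_tail]
  exact le_sup_left

end IsHighest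

theorem IsSimple.invariants_ne_bot (hM : M.IsSimple) : M.invariants ≠ ⊥ := by
  have := hM.1
  have h := inf_invariants_ne_bot (M := M) (U := ⊤) le_top top_ne_bot
  rwa [top_inf_eq] at h

/-- In a simple supermodule, the invariants meet the lower layers trivially. -/
theorem IsSimple.invariants_inf_tail (hg : IsTriangular g) (hM : M.IsSimple) :
    M.invariants ⊓ M.tail M.invariants = ⊥ := by
  by_contra hne
  have hhigh : M.IsHighest (M.invariants ⊓ M.tail M.invariants) := by
    refine ⟨fun w hw => ⟨parity_mem_invariants hw.1, ?_⟩, le_inf ?_ ?_, inf_le_left⟩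
    · refine Submodule.iSup_induction _ (motive := fun u => M.parity u ∈ M.tail M.invariants) hw.2
        (fun i v hv => Submodule.mem_iSup_of_mem i
          (M.isHighest_invariants.parity_mem_layer (i + 1) hv)) ?_ fun x y hx hy => ?_
      · rw [map_zero]
        exact zero_mem _
      · rw [map_add]
        exact add_mem hx hy
    · exact (Submodule.smul_mono le_rfl inf_le_left).trans ops_zero_smul_invariants
    · refine (Submodule.smul_mono le_rfl inf_le_right).trans ?_
      rw [tail, Submodule.smul_iSup]
      exact iSup_mono fun i => M.isHighest_invariants.ops_zero_smul_layer_le (i + 1)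
  -- A nonzero intersection generates M, yet it and its tail lie in the tail of the invariants. Then
  -- g_{-1}M = M, which contradicts nilpotency of g_{-1}.
  have htop : M.tail M.invariants = ⊤ := by
    rw [eq_top_iff, ← hhigh.sup_tail_eq_top hg hM hne]
    exact sup_le inf_le_right (M.tail_mono inf_le_left)
  have hstep : M.ops (-1) • (⊤ : Submodule ℂ V) = ⊤ := by
    rw [eq_top_iff]
    conv_lhs => rw [← htop, tail_eq_smul]
    exact Submodule.smul_mono le_rfl le_top
  have hpow : ∀ i : ℕ, M.ops (-1) ^ i • (⊤ : Submodule ℂ V) = ⊤ := by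
    intro i
    induction i with
    | zero => rw [Submodule.pow_zero, Submodule.one_smul]
    | succ i ih => rw [pow_succ_smul, ih, hstep]
  obtain ⟨d, hd⟩ := M.exists_ops_pow_eq_bot (Or.inr rfl)
  have h1 := hpow d
  rw [hd, Submodule.bot_smul] at h1
  have := hM.1
  exact bot_ne_top h1

/-- The invariants of a simple supermodule are simple over `g_0`. -/
theorem IsSimple.eq_invariants (hg : IsTriangular g) (hM : M.IsSimple) {W : Submodule ℂ V}
    (hW : M.IsHighest W) (h0 : W ≠ ⊥) : W = M.invariants := by
  refine le_antisymm hW.le_invariants fun v hv => ?_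
  have hv' : v ∈ W ⊔ M.tail W := by
    rw [hW.sup_tail_eq_top hg hM h0]
    exact Submodule.mem_top
  obtain ⟨w, hw, t, ht, rfl⟩ := Submodule.mem_sup.mp hv'
  -- The tail component of an invariant vector is itself invariant, hence zero.
  have ht0 : t ∈ M.invariants ⊓ M.tail M.invariants :=
    ⟨(M.invariants.add_mem_iff_right (hW.le_invariants hw)).mp hv, M.tail_mono hW.le_invariants ht⟩
  rw [hM.invariants_inf_tail hg, Submodule.mem_bot] at ht0
  rwa [ht0, add_zero]

theorem IsSimple.iSup_layer_eq_top (hg : IsTriangular g) (hM : M.IsSimple) :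
    ⨆ i, M.layer M.invariants i = ⊤ := by
  rw [← sup_tail]
  exact M.isHighest_invariants.sup_tail_eq_top hg hM hM.invariants_ne_bot

theorem IsHighest.ops_one_pow_smul_layer_le {W : Submodule ℂ V} (hW : M.IsHighest W) (i k : ℕ) :
    M.ops 1 ^ i • M.layer W (i + k) ≤ M.layer W k := by
  induction i generalizing k with
  | zero => rw [Submodule.pow_zero, Submodule.one_smul, zero_add]
  | succ i ih =>
    rw [pow_succ_smul, add_assoc, add_comm 1 k]
    exact (Submodule.smul_mono le_rfl (ih (k + 1))).trans (hW.ops_one_smul_layer_succ_le k)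

theorem IsHighest.ops_one_pow_smul_layer_eq_bot {W : Submodule ℂ V} (hW : M.IsHighest W)
    {i k : ℕ} (h : k < i) : M.ops 1 ^ i • M.layer W k = ⊥ := by
  obtain ⟨r, rfl⟩ := Nat.exists_eq_add_of_lt h
  induction r with
  | zero =>
    rw [add_zero, pow_succ_smul, eq_bot_iff, ← hW.ops_one_smul_layer_zero]
    exact Submodule.smul_mono le_rfl (hW.ops_one_pow_smul_layer_le k 0)
  | succ r ih => rw [← add_assoc, pow_succ_smul, ih (by omega), Submodule.smul_bot]

/-- The layers of a simple supermodule are independent. -/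
theorem IsSimple.iSupIndep_layer (hg : IsTriangular g) (hM : M.IsSimple) :
    iSupIndep (M.layer M.invariants) := by
  have hH := M.isHighest_invariants
  have hzero : ∀ X : Submodule ℂ V, X ≤ M.invariants → X ≤ M.tail M.invariants → X = ⊥ := by
    intro X h1 h2
    rw [eq_bot_iff, ← hM.invariants_inf_tail hg]
    exact le_inf h1 h2
  intro j
  rw [disjoint_iff]
  let U := M.layer M.invariants j ⊓ ⨆ i, ⨆ (_ : i ≠ j), M.layer M.invariants i
  -- g_1^j sends layer j into the invariants. It also kills the layers below j and sends those above
  -- j into the tail; the two descriptions of `U` force zero.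
  have htop : M.ops 1 ^ j • U = ⊥ := by
    refine hzero _ ?_ ?_
    · refine (Submodule.smul_mono le_rfl inf_le_left).trans ?_
      exact (hH.ops_one_pow_smul_layer_le j 0).trans (M.layer_zero _).le
    · refine (Submodule.smul_mono le_rfl inf_le_right).trans ?_
      simp only [Submodule.smul_iSup, iSup_le_iff]
      intro i hij
      rcases lt_or_gt_of_ne hij with h | h
      · rw [hH.ops_one_pow_smul_layer_eq_bot h]
        exact bot_le
      · obtain ⟨k, rfl⟩ := Nat.exists_eq_add_of_lt h
        exact (hH.ops_one_pow_smul_layer_le j (k + 1)).trans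
          (le_iSup (fun i => M.layer M.invariants (i + 1)) k)
  -- Descent on i: if g_1^{i+1}U = 0 then g_1^i U is invariant; for i < j it also lies in layer j -
  -- i, inside the tail, so it vanishes. At i = 0 this says U = 0.
  have hdesc : ∀ r i, i + r = j → M.ops 1 ^ i • U = ⊥ := by
    intro r
    induction r with
    | zero =>
      rintro i rfl
      exact htop
    | succ r ih =>
      intro i hi
      refine hzero _ ?_ ?_
      · rw [← ops_one_smul_eq_bot_iff, ← pow_succ_smul]
        exact ih (i + 1) (by omega)
      · refine (Submodule.smul_mono le_rfl inf_le_left).trans ?_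
        rw [← hi]
        exact (hH.ops_one_pow_smul_layer_le i (r + 1)).trans
          (le_iSup (fun i => M.layer M.invariants (i + 1)) r)
  have h0 := hdesc j 0 (zero_add j)
  rwa [Submodule.pow_zero, Submodule.one_smul] at h0

end Supermodule

/-! ### Direct sums, and isomorphisms as graphs. -/

namespace Supermodule

section Prod

variable {L : Type*} [AddCommGroup L] [Module ℂ L] {A : LieSuperalgebra L}
  {g : Subsuperalgebra A} {V : Type*} [AddCommGroup V] [Module ℂ V]
  {W : Type*} [AddCommGroup W] [Module ℂ W] (M : Supermodule g V) (N : Supermodule g W)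

/-- The direct sum of two supermodules. -/
def prod : Supermodule g (V × W) where
  part i := (M.part i).prod (N.part i)
  isCompl := by
    constructor
    · rw [Submodule.disjoint_def]
      rintro ⟨v, w⟩ h0 h1
      exact Prod.ext (Submodule.disjoint_def.mp M.isCompl.disjoint v h0.1 h1.1)
        (Submodule.disjoint_def.mp N.isCompl.disjoint w h0.2 h1.2)
    · rw [codisjoint_iff, eq_top_iff]
      rintro ⟨v, w⟩ -
      obtain ⟨a, ha, b, hb, rfl⟩ := M.exists_even_add_odd v
      obtain ⟨c, hc, d, hd, rfl⟩ := N.exists_even_add_odd w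
      exact Submodule.mem_sup.mpr ⟨(a, c), ⟨ha, hc⟩, (b, d), ⟨hb, hd⟩, rfl⟩
  act :=
    { toFun := fun x => (M.act x).prodMap (N.act x)
      map_add' := fun x y => by
        rw [map_add, map_add, LinearMap.prodMap_add]
      map_smul' := fun c x => by
        rw [map_smul, map_smul, LinearMap.prodMap_smul, RingHom.id_apply] }
  act_mem := fun i j x v hx hv => ⟨M.act_mem i j x v.1 hx hv.1, N.act_mem i j x v.2 hx hv.2⟩
  act_bracket := fun i j x y hx hy => by
    refine LinearMap.ext fun v => Prod.ext ?_ ?_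
    · exact LinearMap.congr_fun (M.act_bracket i j x y hx hy) v.1
    · exact LinearMap.congr_fun (N.act_bracket i j x y hx hy) v.2

theorem prod_act_apply (x : g.carrier) (v : V × W) :
    (M.prod N).act x v = (M.act x v.1, N.act x v.2) := rfl

theorem parity_prod (v : V × W) : (M.prod N).parity v = (M.parity v.1, N.parity v.2) := by
  obtain ⟨⟨a, c⟩, h0, ⟨b, d⟩, h1, rfl⟩ := (M.prod N).exists_even_add_odd v
  rw [map_add, (M.prod N).parity_of_even h0, (M.prod N).parity_of_odd h1]
  simp only [Prod.mk_add_mk, map_add, Prod.neg_mk]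
  rw [M.parity_of_even h0.1, N.parity_of_even h0.2, M.parity_of_odd h1.1, N.parity_of_odd h1.2]

variable {M N}

theorem IsSub.map_fst {P : Submodule ℂ (V × W)} (hP : (M.prod N).IsSub P) :
    M.IsSub (P.map (LinearMap.fst ℂ V W)) := by
  refine ⟨M.isGradedSubspace_iff.mpr ?_, ?_⟩
  · rintro _ ⟨p, hp, rfl⟩
    have h := (M.prod N).isGradedSubspace_iff.mp hP.1 p hp
    rw [parity_prod] at h
    exact ⟨_, h, rfl⟩
  · rintro x _ ⟨p, hp, rfl⟩
    exact ⟨_, hP.2 x p hp, rfl⟩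

theorem IsSub.map_snd {P : Submodule ℂ (V × W)} (hP : (M.prod N).IsSub P) :
    N.IsSub (P.map (LinearMap.snd ℂ V W)) := by
  refine ⟨N.isGradedSubspace_iff.mpr ?_, ?_⟩
  · rintro _ ⟨p, hp, rfl⟩
    have h := (M.prod N).isGradedSubspace_iff.mp hP.1 p hp
    rw [parity_prod] at h
    exact ⟨_, h, rfl⟩
  · rintro x _ ⟨p, hp, rfl⟩
    exact ⟨_, hP.2 x p hp, rfl⟩

theorem IsSub.comap_inl {P : Submodule ℂ (V × W)} (hP : (M.prod N).IsSub P) :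
    M.IsSub (P.comap (LinearMap.inl ℂ V W)) := by
  refine ⟨M.isGradedSubspace_iff.mpr fun v hv => ?_, fun x v hv => ?_⟩
  · have h := (M.prod N).isGradedSubspace_iff.mp hP.1 (v, 0) hv
    rw [parity_prod, map_zero] at h
    exact h
  · have h := hP.2 x (v, 0) hv
    rw [prod_act_apply, map_zero] at h
    exact h

theorem IsSub.comap_inr {P : Submodule ℂ (V × W)} (hP : (M.prod N).IsSub P) :
    N.IsSub (P.comap (LinearMap.inr ℂ V W)) := by
  refine ⟨N.isGradedSubspace_iff.mpr fun v hv => ?_, fun x v hv => ?_⟩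
  · have h := (M.prod N).isGradedSubspace_iff.mp hP.1 (0, v) hv
    rw [parity_prod, map_zero] at h
    exact h
  · have h := hP.2 x (0, v) hv
    rw [prod_act_apply, map_zero] at h
    exact h

/-- A sub-supermodule of `M × N` that is the graph of a bijection is an isomorphism `M ≅ N`. -/
theorem isIso_of_graph {P : Submodule ℂ (V × W)} (hP : (M.prod N).IsSub P)
    (h1 : P.map (LinearMap.fst ℂ V W) = ⊤) (h2 : P.map (LinearMap.snd ℂ V W) = ⊤)
    (h3 : P.comap (LinearMap.inl ℂ V W) = ⊥) (h4 : P.comap (LinearMap.inr ℂ V W) = ⊥) :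
    M.IsIso N := by
  have hinl : ∀ v, (v, (0 : W)) ∈ P → v = 0 := fun v hv => by
    have : v ∈ P.comap (LinearMap.inl ℂ V W) := hv
    rwa [h3, Submodule.mem_bot] at this
  have hinr : ∀ w, ((0 : V), w) ∈ P → w = 0 := fun w hw => by
    have : w ∈ P.comap (LinearMap.inr ℂ V W) := hw
    rwa [h4, Submodule.mem_bot] at this
  have hb1 : Function.Bijective (LinearMap.fst ℂ V W ∘ₗ P.subtype) := by
    constructor
    · rw [← LinearMap.ker_eq_bot, LinearMap.ker_eq_bot']
      rintro ⟨⟨v, w⟩, hp⟩ (rfl : v = 0)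
      exact Subtype.ext (Prod.ext rfl (hinr w hp))
    · intro v
      obtain ⟨p, hp, rfl⟩ : v ∈ P.map (LinearMap.fst ℂ V W) := h1 ▸ Submodule.mem_top
      exact ⟨⟨p, hp⟩, rfl⟩
  have hb2 : Function.Bijective (LinearMap.snd ℂ V W ∘ₗ P.subtype) := by
    constructor
    · rw [← LinearMap.ker_eq_bot, LinearMap.ker_eq_bot']
      rintro ⟨⟨v, w⟩, hp⟩ (rfl : w = 0)
      exact Subtype.ext (Prod.ext (hinl v hp) rfl)
    · intro w
      obtain ⟨p, hp, rfl⟩ : w ∈ P.map (LinearMap.snd ℂ V W) := h2 ▸ Submodule.mem_top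
      exact ⟨⟨p, hp⟩, rfl⟩
  let e₁ := LinearEquiv.ofBijective _ hb1
  let e₂ := LinearEquiv.ofBijective _ hb2
  have he : ∀ v w, (v, w) ∈ P → (e₁.symm.trans e₂) v = w := by
    intro v w hp
    have h : e₁.symm v = ⟨(v, w), hp⟩ := by
      rw [LinearEquiv.symm_apply_eq]
      rfl
    rw [LinearEquiv.trans_apply, h]
    rfl
  have hmem : ∀ v, (v, (e₁.symm.trans e₂) v) ∈ P := by
    intro v
    obtain ⟨⟨v, w⟩, hp, rfl⟩ : v ∈ P.map (LinearMap.fst ℂ V W) := h1 ▸ Submodule.mem_top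
    change (v, (e₁.symm.trans e₂) v) ∈ P
    rwa [he v w hp]
  refine ⟨e₁.symm.trans e₂, fun i v hv => ?_, fun x v => ?_⟩
  -- The graph is stable under parity, so the map commutes with parity and preserves its
  -- eigenspaces.
  · have h := (M.prod N).isGradedSubspace_iff.mp hP.1 _ (hmem v)
    rw [parity_prod] at h
    have h' := he _ _ h
    rcases zmod2_cases i with rfl | rfl
    · rw [M.parity_of_even hv] at h'
      exact N.parity_eq_self_iff.mp h'.symm
    · rw [M.parity_of_odd hv, map_neg] at h'
      exact N.parity_eq_neg_iff.mp h'.symm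
  · exact he _ _ (hP.2 x _ (hmem v))

end Prod

variable {m n : ℕ} {g : Subsuperalgebra (gl m n)} {V : Type*} [AddCommGroup V] [Module ℂ V]
  {W : Type*} [AddCommGroup W] [Module ℂ W] {M : Supermodule g V} {N : Supermodule g W}

theorem layer_prod_le {Γ : Submodule ℂ (V × W)} {U : Submodule ℂ V} {U' : Submodule ℂ W}
    (h : Γ ≤ U.prod U') (i : ℕ) :
    (M.prod N).layer Γ i ≤ (M.layer U i).prod (N.layer U' i) := by
  induction i with
  | zero => simpa only [layer_zero] using h
  | succ i ih =>
    simp only [layer_succ]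
    rw [Submodule.smul_le]
    rintro _ ⟨x, hx, rfl⟩ v hv
    exact ⟨Submodule.smul_mem_smul (M.act_mem_ops hx) (ih hv).1,
      Submodule.smul_mem_smul (N.act_mem_ops hx) (ih hv).2⟩

theorem tail_prod_le {Γ : Submodule ℂ (V × W)} {U : Submodule ℂ V} {U' : Submodule ℂ W}
    (h : Γ ≤ U.prod U') : (M.prod N).tail Γ ≤ (M.tail U).prod (N.tail U') := by
  rw [tail, iSup_le_iff]
  intro i
  exact (layer_prod_le h (i + 1)).trans
    (Submodule.prod_mono (le_iSup (fun i => M.layer U (i + 1)) i)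
      (le_iSup (fun i => N.layer U' (i + 1)) i))

theorem mem_invariants_prod {v : V × W} :
    v ∈ (M.prod N).invariants ↔ v.1 ∈ M.invariants ∧ v.2 ∈ N.invariants := by
  constructor
  · exact fun h => ⟨fun x hx => congrArg Prod.fst (h x hx), fun x hx => congrArg Prod.snd (h x hx)⟩
  · exact fun h x hx => Prod.ext (h.1 x hx) (h.2 x hx)

/-- The graph of an isomorphism between the invariants generates the graph of an isomorphism. -/
theorem isIso_of_highest_graph (hg : IsTriangular g) (hM : M.IsSimple) (hN : N.IsSimple)
    {Γ : Submodule ℂ (V × W)} (hΓ : (M.prod N).IsHighest Γ) (h0 : Γ ≠ ⊥)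
    (h1 : ∀ v, (v, (0 : W)) ∈ Γ → v = 0) (h2 : ∀ w, ((0 : V), w) ∈ Γ → w = 0) : M.IsIso N := by
  have hle : Γ ≤ M.invariants.prod N.invariants := fun p hp =>
    mem_invariants_prod.mp (hΓ.le_invariants hp)
  have hP := hΓ.isSub_iSup_layer hg
  rw [← sup_tail] at hP
  -- The generated submodule has no invariants outside `Γ`: both coordinates of the tail component
  -- are invariant and in a tail, so they vanish.
  have hmem : ∀ p ∈ Γ ⊔ (M.prod N).tail Γ, p.1 ∈ M.invariants → p.2 ∈ N.invariants → p ∈ Γ := by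
    intro p hp hp1 hp2
    obtain ⟨γ, hγ, t, ht, rfl⟩ := Submodule.mem_sup.mp hp
    have ht' := tail_prod_le hle ht
    have e1 : t.1 ∈ M.invariants ⊓ M.tail M.invariants :=
      ⟨(M.invariants.add_mem_iff_right (hle hγ).1).mp hp1, ht'.1⟩
    have e2 : t.2 ∈ N.invariants ⊓ N.tail N.invariants :=
      ⟨(N.invariants.add_mem_iff_right (hle hγ).2).mp hp2, ht'.2⟩
    rw [hM.invariants_inf_tail hg, Submodule.mem_bot] at e1
    rw [hN.invariants_inf_tail hg, Submodule.mem_bot] at e2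
    have : t = 0 := Prod.ext e1 e2
    rwa [this, add_zero]
  obtain ⟨γ, hγ, hγ0⟩ := (Submodule.ne_bot_iff Γ).mp h0
  refine isIso_of_graph hP ?_ ?_ ?_ ?_
  · refine (hM.2 _ hP.map_fst).resolve_left fun h => hγ0 ?_
    have e : γ.1 = 0 := by
      rw [← Submodule.mem_bot ℂ, ← h]
      exact ⟨γ, Submodule.mem_sup_left hγ, rfl⟩
    exact Prod.ext e (h2 γ.2 (e ▸ hγ))
  · refine (hN.2 _ hP.map_snd).resolve_left fun h => hγ0 ?_
    have e : γ.2 = 0 := by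
      rw [← Submodule.mem_bot ℂ, ← h]
      exact ⟨γ, Submodule.mem_sup_left hγ, rfl⟩
    exact Prod.ext (h1 γ.1 (e ▸ hγ)) e
  -- If M × 0 were contained in the submodule, then (v, 0) would lie in `Γ` for every invariant v,
  -- forcing v = 0.
  · refine (hM.2 _ hP.comap_inl).resolve_right fun h => hM.invariants_ne_bot ?_
    rw [eq_bot_iff]
    intro v hv
    have e : v ∈ (⊤ : Submodule ℂ V) := Submodule.mem_top
    rw [← h] at e
    exact h1 v (hmem _ e hv (zero_mem _))
  · refine (hN.2 _ hP.comap_inr).resolve_right fun h => hN.invariants_ne_bot ?_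
    rw [eq_bot_iff]
    intro v hv
    have e : v ∈ (⊤ : Submodule ℂ W) := Submodule.mem_top
    rw [← h] at e
    exact h2 v (hmem _ e (zero_mem _) hv)

end Supermodule

/-! ### The grading element, the supertrace and the derived superalgebra. -/

section Structure

variable {m n : ℕ}

/-- The diagonal matrix `diag(1/2, -1/2)`, whose adjoint action gives the `ℤ`-grading. -/
noncomputable def gradingElement (m n : ℕ) : Mat m n := Matrix.diagonal fun i => 1 / 2 - (pos i : ℂ)

/-- The supertrace. -/
noncomputable def supertrace : Mat m n →ₗ[ℂ] ℂ where
  toFun X := X.toBlocks₁₁.trace - X.toBlocks₂₂.trace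
  map_add' X Y := by
    simp only [Matrix.trace, Matrix.diag, Matrix.toBlocks₁₁, Matrix.toBlocks₂₂, Matrix.of_apply,
      Matrix.add_apply, Finset.sum_add_distrib]
    ring
  map_smul' c X := by
    simp only [Matrix.trace, Matrix.diag, Matrix.toBlocks₁₁, Matrix.toBlocks₂₂, Matrix.of_apply,
      Matrix.smul_apply, smul_eq_mul, ← Finset.mul_sum, RingHom.id_apply]
    ring

theorem supertrace_apply (X : Mat m n) :
    supertrace X = X.toBlocks₁₁.trace - X.toBlocks₂₂.trace := rfl

theorem supertrace_fromBlocks (a : Matrix (Fin m) (Fin m) ℂ) (b : Matrix (Fin m) (Fin n) ℂ)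
    (c : Matrix (Fin n) (Fin m) ℂ) (d : Matrix (Fin n) (Fin n) ℂ) :
    supertrace (Matrix.fromBlocks a b c d) = a.trace - d.trace := by
  rw [supertrace_apply, Matrix.toBlocks_fromBlocks₁₁, Matrix.toBlocks_fromBlocks₂₂]

theorem gradingElement_eq_fromBlocks : gradingElement m n =
    Matrix.fromBlocks ((1 / 2 : ℂ) • 1) 0 0 (-((1 / 2 : ℂ) • 1)) := by
  ext (i | i) (j | j) <;> 
    simp [gradingElement, pos, Matrix.diagonal_apply, Matrix.one_apply]
  split_ifs <;> norm_num

theorem supertrace_gradingElement_ne_zero (hm : 0 < m) :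
    supertrace (gradingElement m n) ≠ 0 := by
  rw [gradingElement_eq_fromBlocks, supertrace_fromBlocks, Matrix.trace_neg, Matrix.trace_smul,
    Matrix.trace_smul, Matrix.trace_one, Matrix.trace_one, Fintype.card_fin, Fintype.card_fin]
  have h : ((m + n : ℕ) : ℂ) ≠ 0 := Nat.cast_ne_zero.mpr (by omega)
  intro h0
  apply h
  push_cast
  simp only [smul_eq_mul] at h0
  linear_combination 2 * h0

theorem supertrace_superComm (X Y : Mat m n) : supertrace (superComm X Y) = 0 := by
  have h : superComm X Y = X * Y - Y * X + (2 : ℂ) • (oddPart Y * oddPart X) := rfl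
  have hX' : oddPart X = Matrix.fromBlocks 0 X.toBlocks₁₂ X.toBlocks₂₁ 0 := rfl
  have hY' : oddPart Y = Matrix.fromBlocks 0 Y.toBlocks₁₂ Y.toBlocks₂₁ 0 := rfl
  rw [h, hX', hY']
  conv_lhs =>
    rw [← Matrix.fromBlocks_toBlocks X, ← Matrix.fromBlocks_toBlocks Y]
  simp only [Matrix.fromBlocks_multiply, sub_eq_add_neg, Matrix.fromBlocks_neg,
    Matrix.fromBlocks_smul, Matrix.fromBlocks_add, supertrace_fromBlocks,
    Matrix.toBlocks_fromBlocks₁₂, Matrix.toBlocks_fromBlocks₂₁,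
    Matrix.trace_add, Matrix.trace_neg, Matrix.trace_smul, mul_zero,
    smul_eq_mul, zero_add, add_zero]
  rw [Matrix.trace_mul_comm X.toBlocks₁₁, Matrix.trace_mul_comm X.toBlocks₁₂,
    Matrix.trace_mul_comm X.toBlocks₂₁, Matrix.trace_mul_comm X.toBlocks₂₂]
  ring

theorem gradingElement_mem_glDegree : gradingElement m n ∈ glDegree m n 0 := by
  intro i j h
  refine Matrix.diagonal_apply_ne _ ?_
  rintro rfl
  simp at h

theorem superComm_gradingElement_left (X : Mat m n) :
    superComm (gradingElement m n) X = gradingElement m n * X - X * gradingElement m n := by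
  have h : superComm (gradingElement m n) X = gradingElement m n * X - X * gradingElement m n +
    (2 : ℂ) • (oddPart X * oddPart (gradingElement m n)) := rfl
  rw [h, oddPart_of_even (glDegree_zero_le gradingElement_mem_glDegree), mul_zero, smul_zero,
    add_zero]

theorem superComm_gradingElement_right (X : Mat m n) :
    superComm X (gradingElement m n) = -superComm (gradingElement m n) X := by
  have h : superComm X (gradingElement m n) = X * gradingElement m n - gradingElement m n * X +
    (2 : ℂ) • (oddPart (gradingElement m n) * oddPart X) := rfl
  rw [superComm_gradingElement_left, h,
    oddPart_of_even (glDegree_zero_le gradingElement_mem_glDegree), zero_mul, smul_zero,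
    add_zero, neg_sub]

theorem superComm_gradingElement {k : ℤ} {X : Mat m n} (hX : X ∈ glDegree m n k) :
    superComm (gradingElement m n) X = (k : ℂ) • X := by
  rw [superComm_gradingElement_left]
  ext i j
  rw [Matrix.sub_apply, gradingElement, Matrix.diagonal_mul, Matrix.mul_diagonal, Matrix.smul_apply,
    smul_eq_mul]
  by_cases h : pos j - pos i = k
  · rw [← h]
    push_cast
    ring
  · rw [hX i j h]
    ring

theorem supertrace_eq_zero_of_mem_glDegree {k : ℤ} (hk : k ≠ 0) {X : Mat m n}
    (hX : X ∈ glDegree m n k) : supertrace X = 0 := by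
  have h1 : X.toBlocks₁₁ = 0 := by
    ext i j
    exact hX _ _ (by simpa [pos] using hk.symm)
  have h2 : X.toBlocks₂₂ = 0 := by
    ext i j
    exact hX _ _ (by simpa [pos] using hk.symm)
  rw [supertrace_apply, h1, h2, Matrix.trace_zero, Matrix.trace_zero, sub_zero]

theorem supertrace_eq_zero_of_odd {X : Mat m n} (hX : X ∈ glPart m n 1) : supertrace X = 0 := by
  rw [← oddPart_of_odd hX]
  exact (supertrace_fromBlocks _ _ _ _).trans (by simp)

theorem lower_mem_glDegree (c : Matrix (Fin n) (Fin m) ℂ) :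
    Matrix.fromBlocks 0 0 c 0 ∈ glDegree m n (-1) := by
  rintro (i | i) (j | j) h <;> simp [pos] at h ⊢

theorem diag_mem_glDegree (a : Matrix (Fin m) (Fin m) ℂ) (d : Matrix (Fin n) (Fin n) ℂ) :
    Matrix.fromBlocks a 0 0 d ∈ glDegree m n 0 := by
  rintro (i | i) (j | j) h <;> simp [pos] at h ⊢

theorem upper_mem_glDegree (b : Matrix (Fin m) (Fin n) ℂ) :
    Matrix.fromBlocks 0 b 0 0 ∈ glDegree m n 1 := by
  rintro (i | i) (j | j) h <;> simp [pos] at h ⊢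

theorem eq_fromBlocks_of_mem_glDegree_zero {X : Mat m n} (hX : X ∈ glDegree m n 0) :
    X = Matrix.fromBlocks X.toBlocks₁₁ 0 0 X.toBlocks₂₂ := by
  ext (i | i) (j | j)
  · rfl
  · exact hX _ _ (by simp [pos])
  · exact hX _ _ (by simp [pos])
  · rfl

theorem lower_add_diag_add_upper (X : Mat m n) :
    Matrix.fromBlocks 0 0 X.toBlocks₂₁ 0 + Matrix.fromBlocks X.toBlocks₁₁ 0 0 X.toBlocks₂₂ +
      Matrix.fromBlocks 0 X.toBlocks₁₂ 0 0 = X := by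
  conv_rhs => rw [← Matrix.fromBlocks_toBlocks X]
  simp [Matrix.fromBlocks_add]

theorem isTriangular_of_isGlOrP {g : Subsuperalgebra (gl m n)} (hg : IsGlOrP g) :
    IsTriangular g := by
  intro X hX
  refine ⟨_, ⟨?_, lower_mem_glDegree X.toBlocks₂₁⟩, _, ⟨?_, diag_mem_glDegree X.toBlocks₁₁ X.toBlocks₂₂⟩,
    _, ⟨?_, upper_mem_glDegree X.toBlocks₁₂⟩, lower_add_diag_add_upper X⟩
  · cases hg with
    | gl => exact Submodule.mem_top
    | p =>
      refine ⟨?_, ?_, ?_⟩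
      · simp
      · simp
      · simpa using hX.2.2
  · cases hg with
    | gl => exact Submodule.mem_top
    | p =>
      refine ⟨?_, ?_, ?_⟩
      · simpa using hX.1
      · simp
      · simp
  · cases hg with
    | gl => exact Submodule.mem_top
    | p =>
      refine ⟨?_, ?_, ?_⟩
      · simp
      · simpa using hX.2.1
      · simp

theorem gradingElement_mem_of_isGlOrP {g : Subsuperalgebra (gl m n)} (hg : IsGlOrP g) :
    gradingElement m n ∈ g.carrier := by
  rw [gradingElement_eq_fromBlocks]
  cases hg with
  | gl => exact Submodule.mem_top
  | p =>
    refine ⟨?_, ?_, ?_⟩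
    · simp
    · simp
    · simp

/-- With z the grading element, X = k⁻¹[z, X]. -/
theorem mem_derived_of_mem_glDegree {g : Subsuperalgebra (gl m n)}
    (hz : gradingElement m n ∈ g.carrier) {k : ℤ} (hk : k ≠ 0) {X : Mat m n}
    (hX : X ∈ g.carrier) (hXk : X ∈ glDegree m n k) : X ∈ g.derived.carrier := by
  have h : (k : ℂ) • X ∈ g.derived.carrier := by
    rw [← superComm_gradingElement hXk]
    exact Submodule.subset_span ⟨_, hz, X, hX, rfl⟩
  exact (Submodule.smul_mem_iff _ (Int.cast_ne_zero.mpr hk)).mp h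

theorem map_mem_derived {g : Subsuperalgebra (gl m n)} {ι : Type*} [Fintype ι] [DecidableEq ι]
    (φ : Matrix ι ι ℂ →ₗ[ℂ] Mat m n) (hmem : ∀ x, φ x ∈ g.carrier)
    (hφ : ∀ x y, φ (x * y - y * x) = superComm (φ x) (φ y)) {a : Matrix ι ι ℂ} (ha : a.trace = 0) :
    φ a ∈ g.derived.carrier := by
  have h := Submodule.mem_map_of_mem (f := φ) (mem_span_commutators_of_trace_eq_zero a ha)
  rw [Submodule.map_span] at h
  refine Submodule.span_mono ?_ h
  rintro _ ⟨_, ⟨x, y, rfl⟩, rfl⟩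
  exact ⟨φ x, hmem x, φ y, hmem y, (hφ x y).symm⟩

theorem superComm_diag (a a' : Matrix (Fin m) (Fin m) ℂ) (d d' : Matrix (Fin n) (Fin n) ℂ) :
    superComm (Matrix.fromBlocks a 0 0 d) (Matrix.fromBlocks a' 0 0 d') =
      Matrix.fromBlocks (a * a' - a' * a) 0 0 (d * d' - d' * d) := by
  rw [superComm_homogeneous 0 0 _ _ (glDegree_zero_le (diag_mem_glDegree a d))
    (glDegree_zero_le (diag_mem_glDegree a' d')), sgn_zero_left, one_smul]
  simp [Matrix.fromBlocks_multiply, sub_eq_add_neg, Matrix.fromBlocks_neg, Matrix.fromBlocks_add]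

/-- The embedding of `gl(m)` as the upper left block. -/
def upperLeft : Matrix (Fin m) (Fin m) ℂ →ₗ[ℂ] Mat m n where
  toFun a := Matrix.fromBlocks a 0 0 0
  map_add' a b := by simp [Matrix.fromBlocks_add]
  map_smul' c a := by simp [Matrix.fromBlocks_smul]

/-- The embedding of `gl(n)` as the lower right block. -/
def lowerRight : Matrix (Fin n) (Fin n) ℂ →ₗ[ℂ] Mat m n where
  toFun a := Matrix.fromBlocks 0 0 0 a
  map_add' a b := by simp [Matrix.fromBlocks_add]
  map_smul' c a := by simp [Matrix.fromBlocks_smul]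

/-- The embedding of `gl(n)` in `p(n)`. -/
def periplecticEven : Matrix (Fin n) (Fin n) ℂ →ₗ[ℂ] Mat n n where
  toFun a := Matrix.fromBlocks a 0 0 (-a.transpose)
  map_add' a b := by simp [Matrix.fromBlocks_add, add_comm]
  map_smul' c a := by simp [Matrix.fromBlocks_smul]

theorem periplecticEven_apply (a : Matrix (Fin n) (Fin n) ℂ) :
    periplecticEven a = Matrix.fromBlocks a 0 0 (-a.transpose) := rfl

theorem diag_mem_derived_gl (hm : 0 < m) (hn : 0 < n) {a : Matrix (Fin m) (Fin m) ℂ}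
    {d : Matrix (Fin n) (Fin n) ℂ} (h : a.trace = d.trace) :
    Matrix.fromBlocks a 0 0 d ∈ (Subsuperalgebra.whole (gl m n)).derived.carrier := by
  let i : Fin m := ⟨0, hm⟩
  let j : Fin n := ⟨0, hn⟩
  let E : Mat m n := Matrix.fromBlocks 0 (Matrix.single i j 1) 0 0
  let F : Mat m n := Matrix.fromBlocks 0 0 (Matrix.single j i 1) 0
  have hEF : superComm E F =
      Matrix.fromBlocks (Matrix.single i i 1) 0 0 (Matrix.single j j 1) := by
    rw [superComm_homogeneous 1 1 E F (glDegree_one_le (upper_mem_glDegree _))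
      (by simpa using glDegree_le_glPart (-1) (lower_mem_glDegree (Matrix.single j i (1 : ℂ)))),
      sgn_one_one]
    simp [E, F, Matrix.fromBlocks_multiply, Matrix.fromBlocks_add]
  have h1 : superComm E F ∈ (Subsuperalgebra.whole (gl m n)).derived.carrier :=
    Submodule.subset_span ⟨E, Submodule.mem_top, F, Submodule.mem_top, rfl⟩
  have h2 : upperLeft (a - a.trace • Matrix.single i i 1) ∈
      (Subsuperalgebra.whole (gl m n)).derived.carrier := by
    refine map_mem_derived upperLeft (fun _ => Submodule.mem_top) (fun x y => ?_) ?_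
    · simp [upperLeft, superComm_diag]
    · simp [Matrix.trace_sub]
  have h3 : lowerRight (d - a.trace • Matrix.single j j 1) ∈
      (Subsuperalgebra.whole (gl m n)).derived.carrier := by
    refine map_mem_derived lowerRight (fun _ => Submodule.mem_top) (fun x y => ?_) ?_
    · simp [lowerRight, superComm_diag]
    · simp [Matrix.trace_sub, h]
  -- The bracket [E, F] = E_ii ⊕ E_jj absorbs the common trace and leaves two trace-zero blocks,
  -- which are sums of commutators.
  have h4 : Matrix.fromBlocks a 0 0 d = upperLeft (a - a.trace • Matrix.single i i 1) +
      lowerRight (d - a.trace • Matrix.single j j 1) + a.trace • superComm E F := by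
    rw [hEF]
    simp [upperLeft, lowerRight, Matrix.fromBlocks_add, Matrix.fromBlocks_smul]
  rw [h4]
  exact add_mem (add_mem h2 h3) (Submodule.smul_mem _ _ h1)

/-- The supertrace kills brackets. Conversely, degrees ±1 are reached by bracketing with the grading
element, so only block diagonal matrices need work. -/
theorem mem_derived_iff (hm : 0 < m) (hn : 0 < n) {g : Subsuperalgebra (gl m n)} (hg : IsGlOrP g)
    {X : Mat m n} : X ∈ g.derived.carrier ↔ X ∈ g.carrier ∧ supertrace X = 0 := by
  constructor
  · refine fun hX => ⟨g.derived_le hX, ?_⟩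
    have : g.derived.carrier ≤ LinearMap.ker (supertrace (m := m) (n := n)) := by
      refine Submodule.span_le.mpr ?_
      rintro _ ⟨x, -, y, -, rfl⟩
      exact supertrace_superComm x y
    exact this hX
  · rintro ⟨hX, hstr⟩
    have hz := gradingElement_mem_of_isGlOrP hg
    obtain ⟨a, ha, b, hb, c, hc, rfl⟩ := isTriangular_of_isGlOrP hg X hX
    rw [map_add, map_add, supertrace_eq_zero_of_mem_glDegree (by decide) ha.2,
      supertrace_eq_zero_of_mem_glDegree (by decide) hc.2, zero_add, add_zero] at hstr
    refine add_mem (add_mem (mem_derived_of_mem_glDegree hz (by decide) ha.1 ha.2) ?_)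
      (mem_derived_of_mem_glDegree hz (by decide) hc.1 hc.2)
    have hb' := eq_fromBlocks_of_mem_glDegree_zero hb.2
    rw [supertrace_apply] at hstr
    cases hg with
    | gl =>
      rw [hb']
      exact diag_mem_derived_gl hm hn (sub_eq_zero.mp hstr)
    | p =>
      obtain ⟨h1, -, -⟩ := hb.1
      -- On p(n) the supertrace is 2 tr(a), so `a` is a sum of commutators.
      rw [h1, Matrix.trace_neg, Matrix.trace_transpose, sub_neg_eq_add, ← two_mul] at hstr
      have h2 : b = periplecticEven b.toBlocks₁₁ := by
        conv_lhs => rw [hb', h1]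
        rfl
      rw [h2]
      refine map_mem_derived periplecticEven (fun x => ?_) (fun x y => ?_)
        ((mul_eq_zero.mp hstr).resolve_left two_ne_zero)
      · refine ⟨?_, ?_, ?_⟩ <;> simp [periplecticEven_apply]
      · simp [periplecticEven_apply, superComm_diag]

theorem isTriangular_derived (hm : 0 < m) (hn : 0 < n) {g : Subsuperalgebra (gl m n)}
    (hg : IsGlOrP g) : IsTriangular g.derived := by
  intro X hX
  have hz := gradingElement_mem_of_isGlOrP hg
  have hX' := (mem_derived_iff hm hn hg).mp hX
  obtain ⟨a, ha, b, hb, c, hc, rfl⟩ := isTriangular_of_isGlOrP hg X hX'.1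
  have hstr := hX'.2
  rw [map_add, map_add, supertrace_eq_zero_of_mem_glDegree (by decide) ha.2,
    supertrace_eq_zero_of_mem_glDegree (by decide) hc.2, zero_add, add_zero] at hstr
  exact ⟨a, ⟨mem_derived_of_mem_glDegree hz (by decide) ha.1 ha.2, ha.2⟩,
    b, ⟨(mem_derived_iff hm hn hg).mpr ⟨hb.1, hstr⟩, hb.2⟩,
    c, ⟨mem_derived_of_mem_glDegree hz (by decide) hc.1 hc.2, hc.2⟩, rfl⟩

end Structure

/-! ### Schur's lemma for the invariants. -/

namespace Supermodule

section Scalar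

variable {m n : ℕ} {g : Subsuperalgebra (gl m n)} {V : Type*} [AddCommGroup V] [Module ℂ V]
  {M : Supermodule g V}

/-- By simplicity over g_0, one nonzero vector generates the invariants under parity and finitely
many operators spanning the action of g_0. -/
theorem IsSimple.rank_invariants_le (hg : IsTriangular g) (hM : M.IsSimple) :
    Module.rank ℂ M.invariants ≤ Cardinal.aleph0 := by
  obtain ⟨v, hv, hv0⟩ := (Submodule.ne_bot_iff _).mp hM.invariants_ne_bot
  obtain ⟨T, hT, hspan⟩ := Submodule.fg_def.mp
    ((Submodule.fg_iff_finiteDimensional (M.ops 0)).mpr inferInstance)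
  let B := Algebra.adjoin ℂ (insert M.parity T)
  have hB : ∀ a ∈ B, ∀ w ∈ M.invariants, a w ∈ M.invariants := by
    intro a ha
    induction ha using Algebra.adjoin_induction with
    | mem x hx =>
      rcases hx with rfl | hx
      · exact fun w => parity_mem_invariants
      · intro w hw
        have hx' : x ∈ M.ops 0 := hspan ▸ Submodule.subset_span hx
        exact ops_zero_smul_invariants (Submodule.smul_mem_smul hx' hw)
    | algebraMap r => exact fun w hw => M.invariants.smul_mem r hw
    | add x y _ _ hx hy => exact fun w hw => add_mem (hx w hw) (hy w hw)
    | mul x y _ _ hx hy => exact fun w hw => hx _ (hy w hw)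
  have hops : ∀ S ∈ M.ops 0, S ∈ B := by
    intro S hS
    have h1 : M.ops 0 ≤ Subalgebra.toSubmodule B := by
      rw [← hspan, Submodule.span_le]
      exact fun x hx => Algebra.subset_adjoin (Set.mem_insert_of_mem _ hx)
    exact h1 hS
  let U : Submodule ℂ V := (Subalgebra.toSubmodule B).map (LinearMap.applyₗ v)
  have hU : M.IsHighest U := by
    refine ⟨?_, ?_, ?_⟩
    · rintro _ ⟨a, ha, rfl⟩
      exact ⟨M.parity * a, B.mul_mem (Algebra.subset_adjoin (Set.mem_insert _ _)) ha, rfl⟩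
    · rw [Submodule.smul_le]
      rintro S hS _ ⟨a, ha, rfl⟩
      exact ⟨S * a, B.mul_mem (hops S hS) ha, rfl⟩
    · rintro _ ⟨a, ha, rfl⟩
      exact hB a ha v hv
  have hvU : v ∈ U := ⟨1, B.one_mem, rfl⟩
  rw [← hM.eq_invariants hg hU ((Submodule.ne_bot_iff _).mpr ⟨v, hvU, hv0⟩)]
  refine rank_le_aleph0_of_adjoin (hT.countable.insert M.parity) v U ?_
  rintro _ ⟨a, ha, rfl⟩
  exact ⟨a, ha, rfl⟩

/-- Schur's lemma for the invariants of a simple supermodule. -/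
theorem IsSimple.exists_scalar (hg : IsTriangular g) (hM : M.IsSimple) {Z : Module.End ℂ V}
    (hmem : ∀ v ∈ M.invariants, Z v ∈ M.invariants) (hp : ∀ v, M.parity (Z v) = Z (M.parity v))
    (hZ : ∀ S ∈ M.ops 0, ∀ v, S (Z v) = Z (S v)) :
    ∃ a : ℂ, ∀ v ∈ M.invariants, Z v = a • v := by
  have hnt : Nontrivial M.invariants := Submodule.nontrivial_iff_ne_bot.mpr hM.invariants_ne_bot
  obtain ⟨a, ha⟩ := exists_not_bijective_sub_algebraMap (hM.rank_invariants_le hg) (Z.restrict hmem)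
  refine ⟨a, ?_⟩
  by_contra! hne
  apply ha
  have hH := M.isHighest_invariants
  -- Kernel and image of Z - a on the invariants are graded and g_0-stable. If Z - a is nonzero
  -- there, simplicity makes it bijective, contrary to the choice of `a`.
  let Y : Module.End ℂ V := Z - algebraMap ℂ _ a
  have hY : ∀ v, Y v = Z v - a • v := fun _ => rfl
  have hYS : ∀ S ∈ M.ops 0, ∀ v, S (Y v) = Y (S v) := fun S hS v => by
    rw [hY, hY, map_sub, map_smul, hZ S hS]
  have hYp : ∀ v, M.parity (Y v) = Y (M.parity v) := fun v => by
    rw [hY, hY, map_sub, map_smul, hp]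
  have hYmem : ∀ v ∈ M.invariants, Y v ∈ M.invariants := fun v hv =>
    sub_mem (hmem v hv) (Submodule.smul_mem _ _ hv)
  have hker : LinearMap.ker Y ⊓ M.invariants = ⊥ := by
    by_contra h0
    have hK : M.IsHighest (LinearMap.ker Y ⊓ M.invariants) := by
      refine ⟨fun w hw => ⟨?_, hH.parity_mem w hw.2⟩, ?_, inf_le_right⟩
      · rw [SetLike.mem_coe, LinearMap.mem_ker, ← hYp, LinearMap.mem_ker.mp hw.1, map_zero]
      · rw [Submodule.smul_le]
        intro S hS w hw
        refine ⟨?_, hH.ops_zero_smul_le (Submodule.smul_mem_smul hS hw.2)⟩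
        rw [SetLike.mem_coe, LinearMap.mem_ker, Module.End.smul_def, ← hYS S hS, LinearMap.mem_ker.mp hw.1, map_zero]
    obtain ⟨v, hv, hv'⟩ := hne
    rw [← hM.eq_invariants hg hK h0] at hv
    exact hv' (sub_eq_zero.mp hv.1)
  have hinj : ∀ v ∈ M.invariants, Y v = 0 → v = 0 := fun v hv h => by
    have : v ∈ LinearMap.ker Y ⊓ M.invariants := ⟨h, hv⟩
    rwa [hker, Submodule.mem_bot] at this
  have hR : M.IsHighest (M.invariants.map Y) := by
    refine ⟨?_, ?_, ?_⟩
    · rintro _ ⟨w, hw, rfl⟩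
      exact ⟨_, hH.parity_mem w hw, (hYp w).symm⟩
    · rw [Submodule.smul_le]
      rintro S hS _ ⟨w, hw, rfl⟩
      exact ⟨_, hH.ops_zero_smul_le (Submodule.smul_mem_smul hS hw), (hYS S hS w).symm⟩
    · rintro _ ⟨w, hw, rfl⟩
      exact hYmem w hw
  have hR0 : M.invariants.map Y ≠ ⊥ := by
    obtain ⟨v, hv, hv0⟩ := (Submodule.ne_bot_iff _).mp hM.invariants_ne_bot
    exact (Submodule.ne_bot_iff _).mpr ⟨_, ⟨v, hv, rfl⟩, fun h => hv0 (hinj v hv h)⟩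
  have hsurj := hM.eq_invariants hg hR hR0
  constructor
  · rw [← LinearMap.ker_eq_bot, LinearMap.ker_eq_bot']
    intro v hv
    exact Subtype.ext (hinj v v.2 (congrArg Subtype.val hv))
  · intro v
    have hv : (v : V) ∈ M.invariants.map Y := hsurj.ge v.2
    obtain ⟨w, hw, hwv⟩ := hv
    exact ⟨⟨w, hw⟩, Subtype.ext hwv⟩

end Scalar

/-! ### The grading operator. -/

section GradingOperator

variable {m n : ℕ} {g : Subsuperalgebra (gl m n)} {V : Type*} [AddCommGroup V] [Module ℂ V]
  {M : Supermodule g V}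

theorem IsSimple.ext_layer (hg : IsTriangular g) (hM : M.IsSimple) {S T : Module.End ℂ V}
    (h : ∀ i, ∀ v ∈ M.layer M.invariants i, S v = T v) : S = T := by
  have hle : (⊤ : Submodule ℂ V) ≤ LinearMap.eqLocus S T := by
    rw [← hM.iSup_layer_eq_top hg, iSup_le_iff]
    exact h
  exact LinearMap.ext fun v => hle Submodule.mem_top

/-- A simple supermodule carries an operator that acts by `-i` on its `i`-th layer. -/
theorem IsSimple.exists_gradingOperator (hg : IsTriangular g) (hM : M.IsSimple) :
    ∃ D : Module.End ℂ V, ∀ i, ∀ v ∈ M.layer M.invariants i, D v = -(i : ℂ) • v := by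
  classical
  have hint := DirectSum.isInternal_submodule_of_iSupIndep_of_iSup_eq_top
    (hM.iSupIndep_layer hg) (hM.iSup_layer_eq_top hg)
  let e := LinearEquiv.ofBijective (DirectSum.coeLinearMap (M.layer M.invariants)) hint
  refine ⟨DirectSum.toModule ℂ ℕ V (fun i => -(i : ℂ) • (M.layer M.invariants i).subtype) ∘ₗ
    e.symm.toLinearMap, fun i v hv => ?_⟩
  have h : e.symm v = DirectSum.lof ℂ ℕ (fun i => M.layer M.invariants i) i ⟨v, hv⟩ := by
    rw [LinearEquiv.symm_apply_eq]
    exact (DirectSum.coeLinearMap_lof (M.layer M.invariants) i ⟨v, hv⟩).symm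
  rw [LinearMap.comp_apply, LinearEquiv.coe_coe, h, DirectSum.toModule_lof]
  rfl

variable {D : Module.End ℂ V}

/-- An operator of degree `k` moves layer i to layer i - k, where `D` is larger by k; on layer 0 an
operator of degree 1 vanishes. -/
theorem IsSimple.gradingOperator_comm (hg : IsTriangular g) (hM : M.IsSimple)
    (hD : ∀ i, ∀ v ∈ M.layer M.invariants i, D v = -(i : ℂ) • v) {k : ℤ}
    (hk : k = -1 ∨ k = 0 ∨ k = 1) {S : Module.End ℂ V} (hS : S ∈ M.ops k) :
    D * S - S * D = (k : ℂ) • S := by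
  have hH := M.isHighest_invariants
  refine hM.ext_layer hg fun i v hv => ?_
  have hSv : S v ∈ _ := Submodule.smul_mem_smul hS hv
  rw [LinearMap.sub_apply, Module.End.mul_apply, Module.End.mul_apply, hD i v hv, map_smul,
    LinearMap.smul_apply]
  rcases hk with rfl | rfl | rfl
  · rw [← layer_succ] at hSv
    rw [hD _ _ hSv]
    push_cast
    module
  · rw [hD _ _ (hH.ops_zero_smul_layer_le i hSv)]
    push_cast
    module
  · cases i with
    | zero =>
      rw [hH.ops_one_smul_layer_zero, Submodule.mem_bot] at hSv
      simp [hSv]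
    | succ i =>
      rw [hD _ _ (hH.ops_one_smul_layer_succ_le i hSv)]
      push_cast
      module

theorem IsSimple.parity_gradingOperator (hg : IsTriangular g) (hM : M.IsSimple)
    (hD : ∀ i, ∀ v ∈ M.layer M.invariants i, D v = -(i : ℂ) • v) (v : V) :
    M.parity (D v) = D (M.parity v) := by
  have h : M.parity * D = D * M.parity := by
    refine hM.ext_layer hg fun i v hv => ?_
    rw [Module.End.mul_apply, Module.End.mul_apply, hD i v hv, map_smul,
      hD i _ (M.isHighest_invariants.parity_mem_layer i hv)]
  exact LinearMap.congr_fun h v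

end GradingOperator

end Supermodule

/-! ### The splitting g = g' ⊕ ℂz, and restriction to g'. -/

section Restriction

variable {m n : ℕ} {g : Subsuperalgebra (gl m n)} {V : Type*} [AddCommGroup V] [Module ℂ V]
  {W : Type*} [AddCommGroup W] [Module ℂ W]

/-- The multiple of the supertrace that is `1` on the grading element. -/
noncomputable def normalizedSupertrace (m n : ℕ) : Mat m n →ₗ[ℂ] ℂ :=
  (supertrace (gradingElement m n))⁻¹ • supertrace

theorem normalizedSupertrace_eq_zero {X : Mat m n} (hX : supertrace X = 0) :
    normalizedSupertrace m n X = 0 := by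
  rw [normalizedSupertrace, LinearMap.smul_apply, hX, smul_zero]

theorem sub_smul_gradingElement_mem_derived (hm : 0 < m) (hn : 0 < n) (hg : IsGlOrP g) {X : Mat m n}
    (hX : X ∈ g.carrier) :
    X - normalizedSupertrace m n X • gradingElement m n ∈ g.derived.carrier := by
  rw [mem_derived_iff hm hn hg]
  refine ⟨sub_mem hX (Submodule.smul_mem _ _ (gradingElement_mem_of_isGlOrP hg)), ?_⟩
  rw [map_sub, map_smul, normalizedSupertrace, LinearMap.smul_apply, smul_eq_mul, smul_eq_mul,
    mul_right_comm, inv_mul_cancel₀ (supertrace_gradingElement_ne_zero hm), one_mul, sub_self]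

/-- The projection of `g` onto its derived superalgebra along the grading element. -/
noncomputable def derivedProj (hm : 0 < m) (hn : 0 < n) (hg : IsGlOrP g) :
    g.carrier →ₗ[ℂ] g.derived.carrier :=
  LinearMap.codRestrict _ (g.carrier.subtype -
      ((normalizedSupertrace m n).smulRight (gradingElement m n)) ∘ₗ g.carrier.subtype)
    fun x => sub_smul_gradingElement_mem_derived hm hn hg x.2

theorem coe_derivedProj (hm : 0 < m) (hn : 0 < n) (hg : IsGlOrP g) (x : g.carrier) :
    (derivedProj hm hn hg x : Mat m n) =
      x - normalizedSupertrace m n x • gradingElement m n := rfl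

theorem coe_eq_derivedProj_add (hm : 0 < m) (hn : 0 < n) (hg : IsGlOrP g) (x : g.carrier) :
    (x : Mat m n) = derivedProj hm hn hg x + normalizedSupertrace m n x • gradingElement m n := by
  rw [coe_derivedProj, sub_add_cancel]

theorem derivedProj_of_mem_derived (hm : 0 < m) (hn : 0 < n) (hg : IsGlOrP g) {x : g.carrier}
    (hx : (x : Mat m n) ∈ g.derived.carrier) : derivedProj hm hn hg x = ⟨x, hx⟩ := by
  refine Subtype.ext ?_
  rw [coe_derivedProj, normalizedSupertrace_eq_zero ((mem_derived_iff hm hn hg).mp hx).2, zero_smul,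
    sub_zero]

theorem normalizedSupertrace_of_odd {X : Mat m n} (hX : X ∈ glPart m n 1) :
    normalizedSupertrace m n X = 0 :=
  normalizedSupertrace_eq_zero (supertrace_eq_zero_of_odd hX)

theorem derivedProj_mem_glPart (hm : 0 < m) (hn : 0 < n) (hg : IsGlOrP g) {i : ZMod 2}
    {x : g.carrier} (hx : (x : Mat m n) ∈ glPart m n i) :
    (derivedProj hm hn hg x : Mat m n) ∈ glPart m n i := by
  rw [coe_derivedProj]
  rcases zmod2_cases i with rfl | rfl
  · exact sub_mem hx (Submodule.smul_mem _ _ (glDegree_zero_le gradingElement_mem_glDegree))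
  · rwa [normalizedSupertrace_of_odd hx, zero_smul, sub_zero]

namespace Supermodule

theorem ext_of_act_eq {L : Type*} [AddCommGroup L] [Module ℂ L] {A : LieSuperalgebra L}
    {h : Subsuperalgebra A} {M N : Supermodule h V} (hp : M.part = N.part) (ha : M.act = N.act) :
    M = N := by
  cases M
  cases N
  cases hp
  cases ha
  rfl

theorem ops_res_le (M : Supermodule g V) (k : ℤ) : (M.res g.derived_le).ops k ≤ M.ops k := by
  rintro _ ⟨x, hx, rfl⟩
  exact M.act_mem_ops (x := Submodule.inclusion g.derived_le x) hx

theorem ops_res (hg : IsGlOrP g) (M : Supermodule g V) {k : ℤ} (hk : k ≠ 0) :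
    (M.res g.derived_le).ops k = M.ops k := by
  refine le_antisymm (M.ops_res_le k) ?_
  rintro _ ⟨x, hx, rfl⟩
  exact (M.res g.derived_le).act_mem_ops (x := ⟨x, mem_derived_of_mem_glDegree
    (gradingElement_mem_of_isGlOrP hg) hk x.2 hx⟩) hx

theorem invariants_res (hg : IsGlOrP g) (M : Supermodule g V) :
    (M.res g.derived_le).invariants = M.invariants := by
  ext v
  rw [mem_invariants_iff, mem_invariants_iff, ops_res hg M one_ne_zero]

/-- Restriction to the derived superalgebra preserves simplicity. -/
theorem IsSimple.res_derived (hm : 0 < m) (hn : 0 < n) (hg : IsGlOrP g) {M : Supermodule g V}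
    (hM : M.IsSimple) : (M.res g.derived_le).IsSimple := by
  have htri := isTriangular_of_isGlOrP hg
  let z : g.carrier := ⟨gradingElement m n, gradingElement_mem_of_isGlOrP hg⟩
  have hz0 : (z : Mat m n) ∈ glDegree m n 0 := gradingElement_mem_glDegree
  have hzops := M.act_mem_ops hz0
  -- z commutes with g_0 because ad z is zero in degree 0.
  obtain ⟨a, ha⟩ := hM.exists_scalar htri (Z := M.act z)
    (fun v hv => ops_zero_smul_invariants (Submodule.smul_mem_smul hzops hv))
    (M.parity_ops_zero hzops) (by
      rintro _ ⟨x, hx, rfl⟩ v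
      have h := LinearMap.congr_fun
        (M.act_bracket 0 0 z x (glDegree_zero_le hz0) (glDegree_zero_le hx)) v
      have h0 : (⟨(gl m n).bracket z x, g.bracket_mem z z.2 x x.2⟩ : g.carrier) = 0 := by
        refine Subtype.ext ?_
        change superComm (gradingElement m n) x = 0
        exact (superComm_gradingElement hx).trans (by rw [Int.cast_zero, zero_smul])
      rw [h0, map_zero, sgn_zero_left, one_smul] at h
      exact (sub_eq_zero.mp h.symm).symm)
  refine ⟨hM.1, fun X hX => ?_⟩
  by_cases hX0 : X = ⊥
  · exact Or.inl hX0
  right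
  have hXl : M.ops (-1) • X ≤ X := by
    rw [← ops_res hg M (by decide)]
    exact hX.ops_smul_le (-1)
  have hXu : M.ops 1 • X ≤ X := by
    rw [← ops_res hg M (by decide)]
    exact hX.ops_smul_le 1
  have hhigh : M.IsHighest (X ⊓ M.invariants) := by
    refine ⟨fun w hw => ⟨hX.parity_mem hw.1, parity_mem_invariants hw.2⟩, ?_, inf_le_right⟩
    rw [Submodule.smul_le]
    rintro _ ⟨x, hx, rfl⟩ w hw
    refine ⟨?_, ops_zero_smul_invariants (Submodule.smul_mem_smul (M.act_mem_ops hx) hw.2)⟩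
    -- Modulo g', which preserves `X`, the element x is a multiple of z, which acts on the
    -- invariants by the scalar `a`.
    have hx' : x = Submodule.inclusion g.derived_le (derivedProj hm hn hg x) +
        normalizedSupertrace m n x • z := Subtype.ext (coe_eq_derivedProj_add hm hn hg x)
    rw [hx', map_add, map_smul, Module.End.smul_def, LinearMap.add_apply, LinearMap.smul_apply,
      ha w hw.2]
    exact add_mem (hX.2 _ w hw.1) (Submodule.smul_mem _ _ (Submodule.smul_mem _ _ hw.1))
  have heq := hM.eq_invariants htri hhigh (inf_invariants_ne_bot hXu hX0)
  rw [eq_top_iff, ← hM.iSup_layer_eq_top htri, iSup_le_iff]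
  exact M.layer_le_of_le hXl (heq.ge.trans inf_le_left)

/-! ### Extending simple supermodules from g' to g. -/

section Extension

variable {M : Supermodule g.derived V} {D : Module.End ℂ V}

theorem act_superComm_gradingElement (hm : 0 < m) (hn : 0 < n) (hg : IsGlOrP g)
    (hM : M.IsSimple) (hD : ∀ i, ∀ v ∈ M.layer M.invariants i, D v = -(i : ℂ) • v)
    (y w : g.derived.carrier) (hw : (w : Mat m n) = superComm (gradingElement m n) y) :
    M.act w = D * M.act y - M.act y * D := by
  have htri := isTriangular_derived hm hn hg
  obtain ⟨a, ha, b, hb, c, hc, habc⟩ := htri y y.2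
  have hy : y = ⟨a, ha.1⟩ + ⟨b, hb.1⟩ + ⟨c, hc.1⟩ := Subtype.ext habc.symm
  have hw' : w = ((-1 : ℤ) : ℂ) • ⟨a, ha.1⟩ + ((0 : ℤ) : ℂ) • ⟨b, hb.1⟩ +
      ((1 : ℤ) : ℂ) • ⟨c, hc.1⟩ := by
    refine Subtype.ext ?_
    rw [hw, ← habc, map_add, map_add, superComm_gradingElement ha.2, superComm_gradingElement hb.2,
      superComm_gradingElement hc.2]
    rfl
  rw [hw', hy]
  simp only [map_add, map_smul, mul_add, add_mul]
  rw [← hM.gradingOperator_comm htri hD (Or.inl rfl) (M.act_mem_ops (x := ⟨a, ha.1⟩) ha.2),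
    ← hM.gradingOperator_comm htri hD (Or.inr (Or.inl rfl))
      (M.act_mem_ops (x := ⟨b, hb.1⟩) hb.2),
    ← hM.gradingOperator_comm htri hD (Or.inr (Or.inr rfl))
      (M.act_mem_ops (x := ⟨c, hc.1⟩) hc.2)]
  abel

/-- The extension of a simple supermodule over the derived superalgebra, in which the grading
element acts by the grading operator. -/
noncomputable def extend (hm : 0 < m) (hn : 0 < n) (hg : IsGlOrP g) (hM : M.IsSimple)
    (hD : ∀ i, ∀ v ∈ M.layer M.invariants i, D v = -(i : ℂ) • v) : Supermodule g V where
  part := M.part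
  isCompl := M.isCompl
  act := M.act ∘ₗ derivedProj hm hn hg +
    ((normalizedSupertrace m n).smulRight D) ∘ₗ g.carrier.subtype
  act_mem := by
    intro i j x v hx hv
    refine add_mem (M.act_mem i j _ v (derivedProj_mem_glPart hm hn hg hx) hv) ?_
    change (normalizedSupertrace m n x • D) v ∈ _
    rcases zmod2_cases i with rfl | rfl
    · rw [zero_add]
      refine Submodule.smul_mem _ _ ?_
      have hp := hM.parity_gradingOperator (isTriangular_derived hm hn hg) hD v
      rcases zmod2_cases j with rfl | rfl
      · rw [M.parity_of_even hv] at hp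
        exact M.parity_eq_self_iff.mp hp
      · rw [M.parity_of_odd hv, map_neg] at hp
        exact M.parity_eq_neg_iff.mp hp
    · rw [normalizedSupertrace_of_odd hx, zero_smul]
      exact zero_mem _
  act_bracket := by
    intro i j x y hx hy
    have hbr : superComm (x : Mat m n) y ∈ g.derived.carrier :=
      Submodule.subset_span ⟨x, x.2, y, y.2, rfl⟩
    have hX := derivedProj_mem_glPart hm hn hg hx
    have hY := derivedProj_mem_glPart hm hn hg hy
    change M.act (derivedProj hm hn hg ⟨superComm (x : Mat m n) y, _⟩) +
        normalizedSupertrace m n (superComm (x : Mat m n) y) • D =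
      (M.act (derivedProj hm hn hg x) + normalizedSupertrace m n x • D) *
        (M.act (derivedProj hm hn hg y) + normalizedSupertrace m n y • D) -
      sgn i j • ((M.act (derivedProj hm hn hg y) + normalizedSupertrace m n y • D) *
        (M.act (derivedProj hm hn hg x) + normalizedSupertrace m n x • D))
    rw [derivedProj_of_mem_derived hm hn hg hbr, normalizedSupertrace_eq_zero
      (supertrace_superComm _ _), zero_smul, add_zero]
    -- The sign is -1 only when x and y are both odd, and odd elements have no z-component.
    have hcase : sgn i j = 1 ∨
        (normalizedSupertrace m n x = 0 ∧ normalizedSupertrace m n y = 0) := by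
      rcases zmod2_cases i with rfl | rfl
      · exact Or.inl (sgn_zero_left j)
      rcases zmod2_cases j with rfl | rfl
      · exact Or.inl (sgn_zero_right 1)
      · exact Or.inr ⟨normalizedSupertrace_of_odd hx, normalizedSupertrace_of_odd hy⟩
    have hxe := coe_eq_derivedProj_add hm hn hg x
    have hye := coe_eq_derivedProj_add hm hn hg y
    generalize derivedProj hm hn hg x = x' at *
    generalize derivedProj hm hn hg y = y' at *
    generalize normalizedSupertrace m n x = a at *
    generalize normalizedSupertrace m n y = b at *
    have hmemz : ∀ w : g.derived.carrier,
        superComm (gradingElement m n) (w : Mat m n) ∈ g.derived.carrier := fun w =>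
      Submodule.subset_span ⟨_, gradingElement_mem_of_isGlOrP hg, w, g.derived_le w.2, rfl⟩
    -- Writing x = x' + az and y = y' + bz gives [x, y] = [x', y'] + a[z, y'] - b[z, x'], as z is
    -- even and [z, z] = 0.
    have hsplit : (⟨superComm (x : Mat m n) y, hbr⟩ : g.derived.carrier) =
        ⟨(gl m n).bracket x' y', g.derived.bracket_mem x' x'.2 y' y'.2⟩ +
          a • ⟨_, hmemz y'⟩ - b • ⟨_, hmemz x'⟩ := by
      refine Subtype.ext ?_
      change superComm (x : Mat m n) y = superComm (x' : Mat m n) y' +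
        a • superComm (gradingElement m n) y' - b • superComm (gradingElement m n) x'
      have hzz : superComm (gradingElement m n) (gradingElement m n) = 0 := by
        rw [superComm_gradingElement gradingElement_mem_glDegree, Int.cast_zero, zero_smul]
      rw [hxe, hye]
      simp only [map_add, LinearMap.add_apply, map_smul, LinearMap.smul_apply,
        superComm_gradingElement_right (x' : Mat m n), hzz]
      module
    rw [hsplit, map_sub, map_add, map_smul, map_smul, M.act_bracket i j x' y' hX hY,
      act_superComm_gradingElement hm hn hg hM hD y' ⟨_, hmemz y'⟩ rfl,
      act_superComm_gradingElement hm hn hg hM hD x' ⟨_, hmemz x'⟩ rfl]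
    rcases hcase with h | ⟨rfl, rfl⟩
    · rw [h]
      simp only [one_smul, mul_add, add_mul, smul_mul_assoc, mul_smul_comm, smul_sub, smul_add]
      rw [smul_comm a b]
      abel
    · simp only [zero_smul, add_zero, sub_zero]

theorem res_extend (hm : 0 < m) (hn : 0 < n) (hg : IsGlOrP g) (hM : M.IsSimple)
    (hD : ∀ i, ∀ v ∈ M.layer M.invariants i, D v = -(i : ℂ) • v) :
    (extend hm hn hg hM hD).res g.derived_le = M := by
  refine ext_of_act_eq rfl (LinearMap.ext fun x => ?_)
  change M.act (derivedProj hm hn hg (Submodule.inclusion g.derived_le x)) +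
    normalizedSupertrace m n (x : Mat m n) • D = M.act x
  rw [derivedProj_of_mem_derived hm hn hg (x := Submodule.inclusion g.derived_le x) x.2,
    normalizedSupertrace_eq_zero ((mem_derived_iff hm hn hg).mp x.2).2, zero_smul, add_zero]
  rfl

theorem isSimple_of_isSimple_res {M : Supermodule g V} (h : (M.res g.derived_le).IsSimple) :
    M.IsSimple :=
  ⟨h.1, fun U hU => h.2 U ⟨hU.1, fun x u hu => hU.2 (Submodule.inclusion g.derived_le x) u hu⟩⟩

/-- Every simple supermodule over the derived superalgebra is a restriction. -/
theorem IsSimple.exists_res_eq (hm : 0 < m) (hn : 0 < n) (hg : IsGlOrP g) (hM : M.IsSimple) :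
    ∃ N : Supermodule g V, N.IsSimple ∧ N.res g.derived_le = M := by
  obtain ⟨D, hD⟩ := hM.exists_gradingOperator (isTriangular_derived hm hn hg)
  have hres := res_extend hm hn hg hM hD
  exact ⟨extend hm hn hg hM hD, isSimple_of_isSimple_res (hres.symm ▸ hM), hres⟩

end Extension

/-! ### Isomorphisms and invariants. -/

section Isomorphism

theorem parity_map {L : Type*} [AddCommGroup L] [Module ℂ L] {A : LieSuperalgebra L}
    {h : Subsuperalgebra A} {M : Supermodule h V} {N : Supermodule h W} (e : V →ₗ[ℂ] W)
    (he : ∀ i, ∀ v ∈ M.part i, e v ∈ N.part i) (v : V) : e (M.parity v) = N.parity (e v) := by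
  obtain ⟨a, ha, b, hb, rfl⟩ := M.exists_even_add_odd v
  simp only [map_add, M.parity_of_even ha, M.parity_of_odd hb, N.parity_of_even (he 0 a ha),
    N.parity_of_odd (he 1 b hb), map_neg]

/-- Since g_1 lies in g', a g'-isomorphism carries g_1-invariants onto g_1-invariants. -/
theorem invariantsModule_isIso_of_isIso (hg : IsGlOrP g) {M : Supermodule g V}
    {N : Supermodule g W} (h : (M.res g.derived_le).IsIso (N.res g.derived_le)) :
    (M.invariantsModule.res g.derived_degZero_le).IsIso
      (N.invariantsModule.res g.derived_degZero_le) := by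
  obtain ⟨e, hpart, hact⟩ := h
  have hmap : M.invariants.map (e : V →ₗ[ℂ] W) = N.invariants := by
    rw [← invariants_res hg M, ← invariants_res hg N]
    refine le_antisymm ?_ fun w hw => ⟨e.symm w, fun x hx => ?_, e.apply_symm_apply w⟩
    · rintro _ ⟨v, hv, rfl⟩ x hx
      exact (hact x v).symm.trans ((congrArg e (hv x hx)).trans (map_zero e))
    · apply e.injective
      rw [hact, e.apply_symm_apply, map_zero]
      exact hw x hx
  refine ⟨e.ofSubmodules _ _ hmap, fun i v hv => hpart i v hv, fun x v => Subtype.ext ?_⟩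
  exact hact ⟨x, x.2.1⟩ v

/-- The graph argument is run over g', where both restrictions are already known to be simple and
keep the same invariants. -/
theorem isIso_of_invariantsModule_isIso (hm : 0 < m) (hn : 0 < n) (hg : IsGlOrP g)
    {M : Supermodule g V} {N : Supermodule g W} (hM : M.IsSimple) (hN : N.IsSimple)
    (h : (M.invariantsModule.res g.derived_degZero_le).IsIso
      (N.invariantsModule.res g.derived_degZero_le)) :
    (M.res g.derived_le).IsIso (N.res g.derived_le) := by
  obtain ⟨e, hpart, hact⟩ := h
  let γ : M.invariants →ₗ[ℂ] V × W :=
    M.invariants.subtype.prod (N.invariants.subtype ∘ₗ e.toLinearMap)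
  have hγ : ∀ v, γ v = ((v : V), (e v : W)) := fun _ => rfl
  refine isIso_of_highest_graph (isTriangular_derived hm hn hg) (hM.res_derived hm hn hg)
    (hN.res_derived hm hn hg) (Γ := LinearMap.range γ) ⟨?_, ?_, ?_⟩ ?_ ?_ ?_
  · rintro _ ⟨v, rfl⟩
    -- The inclusions of the invariants are homogeneous of degree 0, so parity on the invariants is
    -- the restriction of the ambient one.
    have hpM := parity_map (M := M.invariantsModule.res g.derived_degZero_le)
      (N := M.res (h := g.derived.degZero) (g.derived_degZero_le.trans g.degZero_le))
      M.invariants.subtype (fun i v hv => hv) v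
    have hpN := parity_map (M := N.invariantsModule.res g.derived_degZero_le)
      (N := N.res (h := g.derived.degZero) (g.derived_degZero_le.trans g.degZero_le))
      N.invariants.subtype (fun i v hv => hv) (e v)
    have hpe := parity_map e.toLinearMap hpart v
    refine ⟨(M.invariantsModule.res g.derived_degZero_le).parity v, ?_⟩
    rw [hγ, parity_prod]
    refine Prod.ext hpM ?_
    exact (congrArg Subtype.val hpe).trans hpN
  · rw [Submodule.smul_le]
    rintro _ ⟨x, hx, rfl⟩ _ ⟨v, rfl⟩
    refine ⟨(M.invariantsModule.res g.derived_degZero_le).act ⟨x, x.2, hx⟩ v, ?_⟩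
    rw [hγ, hact]
    rfl
  · rintro _ ⟨v, rfl⟩
    rw [mem_invariants_prod, invariants_res hg, invariants_res hg]
    exact ⟨v.2, (e v).2⟩
  · obtain ⟨v, hv, hv0⟩ := (Submodule.ne_bot_iff _).mp hM.invariants_ne_bot
    exact (Submodule.ne_bot_iff _).mpr ⟨_, ⟨⟨v, hv⟩, rfl⟩, fun h => hv0 (congrArg Prod.fst h)⟩
  · rintro v ⟨w, hw⟩
    have h2 : e w = 0 := Subtype.ext (congrArg Prod.snd hw)
    rw [e.map_eq_zero_iff] at h2
    rw [h2, map_zero] at hw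
    exact (congrArg Prod.fst hw).symm
  · rintro v ⟨w, hw⟩
    have h2 : w = 0 := Subtype.ext (congrArg Prod.fst hw)
    rw [h2, map_zero] at hw
    exact (congrArg Prod.snd hw).symm

end Isomorphism

end Supermodule

end Restriction

end SuperLie

open SuperLie in
theorem proposition4p9 {m n : ℕ} (hm : 0 < m) (hn : 0 < n)
    (g : Subsuperalgebra (gl m n)) (hg : IsGlOrP g) :
    -- restrictions of simple supermodules are simple
    (∀ (V : Type u) [AddCommGroup V] [Module ℂ V] (M : Supermodule g V),
      M.IsSimple → (M.res g.derived_le).IsSimple) ∧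
    -- isomorphism of restrictions
    (∀ (V : Type u) [AddCommGroup V] [Module ℂ V] (W : Type v) [AddCommGroup W] [Module ℂ W]
      (M : Supermodule g V) (N : Supermodule g W), M.IsSimple → N.IsSimple →
      ((M.res g.derived_le).IsIso (N.res g.derived_le) ↔
        (M.invariantsModule.res g.derived_degZero_le).IsIso
          (N.invariantsModule.res g.derived_degZero_le))) ∧
    -- every simple supermodule over the derived superalgebra is a restriction
    (∀ (V : Type u) [AddCommGroup V] [Module ℂ V] (M' : Supermodule g.derived V),
      M'.IsSimple → ∃ M : Supermodule g V, M.IsSimple ∧ M.res g.derived_le = M') := by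
  refine ⟨fun V _ _ M hM => hM.res_derived hm hn hg, fun V _ _ W _ _ M N hM hN => ⟨?_, ?_⟩,
    fun V _ _ M' hM' => hM'.exists_res_eq hm hn hg⟩
  · exact Supermodule.invariantsModule_isIso_of_isIso hg
  · exact Supermodule.isIso_of_invariantsModule_isIso hm hn hg hM hN
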